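/- Let $n\ge 1$, $1\le p,q\le\infty$, $s\in\mathbb R$ and $\alpha>2$. Write $\widehat f(\xi)=\int_{\mathbb R^n} f(x)e^{-ix\cdot\xi}\,dx$ for the Fourier transform, $\vee$ for its inverse, and $\langle\xi\rangle=(1+|\xi|^2)^{1/2}$. Fix $\varphi\in\mathcal S(\mathbb R^n)$ with $\operatorname{supp}\varphi\subset[-1,1]^n$ and $\sum_{k\in\mathbb Z^n}\varphi(\xi-k)=1$ for all $\xi\in\mathbb R^n$, and for $r\in\mathbb R$ let $M^{p,q}_r(\mathbb R^n)$ be the modulation space of all tempered distributions $f$ with $$\|f\|_{M^{p,q}_r}=\Big(\sum_{k\in\mathbb Z^n}\langle k\rangle^{rq}\,\|\varphi(D-k)f\|_{L^p}^q\Big)^{1/q}<\infty,\qquad \varphi(D-k)f=(\varphi(\cdot-k)\widehat f\,)^\vee$$ (with the supremum over $k$ of $\langle k\rangle^{r}\|\varphi(D-k)f\|_{L^p}$ if $q=\infty$). For $f\in\mathcal S(\mathbb R^n)$ let $$e^{i|D|^\alpha}f(x)=(2\pi)^{-n}\int_{\mathbb R^n}e^{i|\xi|^\alpha}\widehat f(\xi)e^{ix\cdot\xi}\,d\xi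 .$$ Suppose that $M^{p,q}_s(\mathbb R^n)\hookrightarrow L^p(\mathbb R^n)$, i.e. every $f\in M^{p,q}_s(\mathbb R^n)$ is given by an $L^p$ function and $\|f\|_{L^p}\le C\|f\|_{M^{p,q}_s}$ with a constant $C>0$ independent of $f$. Then $e^{i|D|^\alpha}$ is bounded from $M^{p,q}_{s+(\alpha-2)n|1/p-1/2|}(\mathbb R^n)$ to $L^p(\mathbb R^n)$, i.e. there is a constant $C'>0$ such that for all $f\in\mathcal S(\mathbb R^n)$ one has $e^{i|D|^\alpha}f\in L^p(\mathbb R^n)$ and $$\|e^{i|D|^\alpha}f\|_{L^p}\le C'\,\|f\|_{M^{p,q}_{s+(\alpha-2)n|1/p-1/2|}} .$$ -/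

import Mathlib

open MeasureTheory FourierTransform SchwartzMap
open scoped ENNReal NNReal

noncomputable section

/-- A lattice point `k ∈ ℤⁿ`, regarded as a point of `ℝⁿ`. -/
def latticePoint {n : ℕ} (k : Fin n → ℤ) : EuclideanSpace ℝ (Fin n) :=
  WithLp.toLp 2 (fun i => (k i : ℝ))

/-- The bracket `⟨ξ⟩ = (1 + |ξ|²)^{1/2}`. -/
def japaneseBracket {n : ℕ} (ξ : EuclideanSpace ℝ (Fin n)) : ℝ :=
  Real.sqrt (1 + ‖ξ‖ ^ 2)

/-- The admissible windows: `φ` is a Schwartz function with `supp φ ⊆ [-1,1]ⁿ` and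
`∑_{k ∈ ℤⁿ} φ(ξ - k) = 1` for every `ξ`. (For each `ξ` the sum has finitely many nonzero terms.) -/
structure IsModulationWindow {n : ℕ} (φ : 𝓢(EuclideanSpace ℝ (Fin n), ℂ)) : Prop where
  support_subset : tsupport φ ⊆ {ξ | ∀ i, |ξ i| ≤ 1}
  sum_eq_one : ∀ ξ, ∑' k : Fin n → ℤ, φ (ξ - latticePoint k) = 1

/-- The operator `φ(D - k)` on tempered distributions, that is
`φ(D - k) f = (φ(· - k) f^)^∨` for the Fourier transform `f^(ξ) = ∫ f(x) e^{-i x·ξ} dx`.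
Mathlib's transform is `𝓕 f (η) = f^(2πη)`, so the Mathlib multiplier of the operator `m(D)`
is `η ↦ m(2πη)`. -/
def boxOperator {n : ℕ} (φ : 𝓢(EuclideanSpace ℝ (Fin n), ℂ)) (k : Fin n → ℤ)
    (f : 𝓢'(EuclideanSpace ℝ (Fin n), ℂ)) : 𝓢'(EuclideanSpace ℝ (Fin n), ℂ) :=
  TemperedDistribution.fourierMultiplierCLM ℂ
    (fun η : EuclideanSpace ℝ (Fin n) => φ ((2 * Real.pi) • η - latticePoint k)) f

/-- The `L^p` norm of a tempered distribution: the norm of the (unique) `L^p` function that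
represents it, and `∞` if there is none. -/
def lpENorm {n : ℕ} (p : ℝ≥0∞) [Fact (1 ≤ p)] (f : 𝓢'(EuclideanSpace ℝ (Fin n), ℂ)) : ℝ≥0∞ :=
  ⨅ (g : Lp ℂ p (volume : Measure (EuclideanSpace ℝ (Fin n))))
    (_ : Lp.toTemperedDistribution g = f), ‖g‖ₑ

/-- The norm `‖f‖_{M^{p,q}_s}`, as an extended nonnegative real; the modulation space `M^{p,q}_s`
consists of the tempered distributions for which it is finite. -/
def modulationENorm {n : ℕ} (φ : 𝓢(EuclideanSpace ℝ (Fin n), ℂ)) (p q : ℝ≥0∞) [Fact (1 ≤ p)]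
    (s : ℝ) (f : 𝓢'(EuclideanSpace ℝ (Fin n), ℂ)) : ℝ≥0∞ :=
  if q = ∞ then
    ⨆ k : Fin n → ℤ,
      ENNReal.ofReal (japaneseBracket (latticePoint k) ^ s) * lpENorm p (boxOperator φ k f)
  else
    (∑' k : Fin n → ℤ,
      ENNReal.ofReal (japaneseBracket (latticePoint k) ^ (s * q.toReal)) *
        lpENorm p (boxOperator φ k f) ^ q.toReal) ^ (1 / q.toReal)

/-- The modulation space `M^{p,q}_s(ℝⁿ)`, as a set of tempered distributions. -/
def modulationSpace {n : ℕ} (φ : 𝓢(EuclideanSpace ℝ (Fin n), ℂ)) (p q : ℝ≥0∞) [Fact (1 ≤ p)]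
    (s : ℝ) : Set 𝓢'(EuclideanSpace ℝ (Fin n), ℂ) :=
  {f | modulationENorm φ p q s f < ∞}

/-- The continuous embedding `M^{p,q}_s(ℝⁿ) ↪ L^p(ℝⁿ)`: every `f ∈ M^{p,q}_s` is (represented by)
an `L^p` function `g`, and `‖g‖_{L^p} ≤ C ‖f‖_{M^{p,q}_s}` with `C` independent of `f`. -/
def ModulationEmbedsInLp {n : ℕ} (φ : 𝓢(EuclideanSpace ℝ (Fin n), ℂ)) (p q : ℝ≥0∞)
    [Fact (1 ≤ p)] (s : ℝ) : Prop :=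
  ∃ C : ℝ≥0, 0 < C ∧ ∀ f ∈ modulationSpace φ p q s,
    ∃ g : Lp ℂ p (volume : Measure (EuclideanSpace ℝ (Fin n))),
      Lp.toTemperedDistribution g = f ∧ ‖g‖ₑ ≤ C * modulationENorm φ p q s f

/-- An operator `T`, defined on Schwartz functions, is bounded from `M^{p,q}_s(ℝⁿ)` to `L^p(ℝⁿ)`:
`‖T f‖_{L^p} ≤ C ‖f‖_{M^{p,q}_s}` for all Schwartz functions `f`. -/
def IsBoundedModulationToLp {n : ℕ} (φ : 𝓢(EuclideanSpace ℝ (Fin n), ℂ)) (p q : ℝ≥0∞)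
    [Fact (1 ≤ p)] (s : ℝ)
    (T : 𝓢(EuclideanSpace ℝ (Fin n), ℂ) → EuclideanSpace ℝ (Fin n) → ℂ) : Prop :=
  ∃ C : ℝ≥0, 0 < C ∧ ∀ f : 𝓢(EuclideanSpace ℝ (Fin n), ℂ),
    MemLp (T f) p volume ∧
      eLpNorm (T f) p volume ≤
        C * modulationENorm φ p q s (f : 𝓢'(EuclideanSpace ℝ (Fin n), ℂ))

/-- The unimodular Fourier multiplier
`e^{i|D|^α} f (x) = (2π)^{-n} ∫ e^{i|ξ|^α} f^(ξ) e^{i x·ξ} dξ`, `f` a Schwartz function, written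
with Mathlib's Fourier transform through the substitution `ξ = 2πη`. -/
def unimodularMultiplier {n : ℕ} (α : ℝ) (f : 𝓢(EuclideanSpace ℝ (Fin n), ℂ)) :
    EuclideanSpace ℝ (Fin n) → ℂ :=
  𝓕⁻ (fun η : EuclideanSpace ℝ (Fin n) =>
    Complex.exp (Complex.I * ((‖(2 * Real.pi) • η‖ ^ α : ℝ) : ℂ)) *
      𝓕 (f : EuclideanSpace ℝ (Fin n) → ℂ) η)

end

section Convolution

variable {V : Type*} [NormedAddCommGroup V] [InnerProductSpace ℝ V] [FiniteDimensional ℝ V]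
  [MeasurableSpace V] [BorelSpace V]

/-- Young's inequality `L¹ * Lᵖ ⊆ Lᵖ` for nonnegative functions. -/
lemma lintegral_lconvolution_rpow_le {K g : V → ℝ≥0∞} (hK : AEMeasurable K) (hg : AEMeasurable g)
    {p : ℝ} (hp : 1 ≤ p) :
    ∫⁻ x, (∫⁻ t, K t * g (x - t)) ^ p ≤ (∫⁻ t, K t) ^ p * ∫⁻ x, g x ^ p := by
  have hp0 : 0 < p := by linarith
  have hgs (x : V) : AEMeasurable (fun t => g (x - t)) :=
    hg.comp_quasiMeasurePreserving (quasiMeasurePreserving_sub_left volume x)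
  have hpt (x : V) : (∫⁻ t, K t * g (x - t)) ^ p
      ≤ (∫⁻ t, K t) ^ (p - 1) * ∫⁻ t, K t * g (x - t) ^ p := by
    have h1 := ENNReal.lintegral_mul_norm_pow_le (μ := volume) (f := K)
      (g := fun t => K t * g (x - t) ^ p) hK (hK.mul ((hgs x).pow_const p))
      (p := 1 - 1 / p) (q := 1 / p) (by rw [sub_nonneg, div_le_one hp0]; exact hp)
      (by positivity) (by ring)
    have h2 (t : V) : K t ^ (1 - 1 / p) * (K t * g (x - t) ^ p) ^ (1 / p) = K t * g (x - t) := by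
      rw [ENNReal.mul_rpow_of_nonneg _ _ (by positivity), ← mul_assoc,
        ← ENNReal.rpow_add_of_nonneg _ _ (by rw [sub_nonneg, div_le_one hp0]; exact hp)
          (by positivity), ← ENNReal.rpow_mul, mul_one_div_cancel hp0.ne']
      simp
    simp only [h2] at h1
    calc _ ≤ ((∫⁻ t, K t) ^ (1 - 1 / p) * (∫⁻ t, K t * g (x - t) ^ p) ^ (1 / p)) ^ p :=
          ENNReal.rpow_le_rpow h1 hp0.le
      _ = _ := by
          rw [ENNReal.mul_rpow_of_nonneg _ _ hp0.le, ← ENNReal.rpow_mul, ← ENNReal.rpow_mul,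
            one_div_mul_cancel hp0.ne', sub_mul, one_div_mul_cancel hp0.ne']
          simp
  have hprod : AEMeasurable (fun z : V × V => K z.2 * g (z.1 - z.2) ^ p)
      ((volume : Measure V).prod volume) :=
    (hK.comp_quasiMeasurePreserving Measure.quasiMeasurePreserving_snd).mul
      ((hg.comp_quasiMeasurePreserving
        (quasiMeasurePreserving_sub_of_right_invariant volume volume)).pow_const p)
  have hinner (x : V) : ∫⁻ y, g (y - x) ^ p = ∫⁻ y, g y ^ p :=
    lintegral_sub_right_eq_self (fun y => g y ^ p) x
  calc _ ≤ ∫⁻ x, (∫⁻ t, K t) ^ (p - 1) * ∫⁻ t, K t * g (x - t) ^ p := lintegral_mono hpt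
    _ = (∫⁻ t, K t) ^ (p - 1) * ∫⁻ x, ∫⁻ t, K t * g (x - t) ^ p :=
        lintegral_const_mul'' _ hprod.lintegral_prod_right'
    _ = (∫⁻ t, K t) ^ (p - 1) * ∫⁻ t, ∫⁻ x, K t * g (x - t) ^ p := by
        rw [lintegral_lintegral_swap hprod]
    _ = (∫⁻ t, K t) ^ (p - 1) * ∫⁻ t, K t * ∫⁻ x, g x ^ p := by
        congr 1
        refine lintegral_congr fun t => ?_
        rw [lintegral_const_mul'', hinner]
        exact (hg.comp_quasiMeasurePreserving
          (measurePreserving_sub_right volume t).quasiMeasurePreserving).pow_const p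
    _ = (∫⁻ t, K t) ^ (p - 1) * ((∫⁻ t, K t) * ∫⁻ x, g x ^ p) := by
        rw [lintegral_mul_const'' _ hK]
    _ = _ := by
        rw [← mul_assoc]
        congr 1
        nth_rewrite 2 [← ENNReal.rpow_one (∫⁻ t, K t)]
        rw [← ENNReal.rpow_add_of_nonneg _ _ (by linarith) zero_le_one]
        simp

/-- Convolution of complex-valued functions. -/
noncomputable def cconv (K g : V → ℂ) : V → ℂ :=
  MeasureTheory.convolution K g (ContinuousLinearMap.mul ℂ ℂ) volume

lemma cconv_apply (K g : V → ℂ) (x : V) : cconv K g x = ∫ t, K t * g (x - t) := rfl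

lemma enorm_cconv_le (K g : V → ℂ) (x : V) : ‖cconv K g x‖ₑ ≤ ∫⁻ t, ‖K t‖ₑ * ‖g (x - t)‖ₑ := by
  rw [cconv_apply]
  refine (enorm_integral_le_lintegral_enorm _).trans (le_of_eq ?_)
  simp [enorm_mul]

lemma MeasureTheory.Integrable.cconv {K g : V → ℂ} (hK : Integrable K) (hg : Integrable g) :
    Integrable (cconv K g) :=
  hK.integrable_convolution _ hg

lemma cconv_add_right {K g₁ g₂ : V → ℂ} (hK : Integrable K) (h₁ : Integrable g₁)
    (h₂ : Integrable g₂) : cconv K (g₁ + g₂) =ᵐ[volume] cconv K g₁ + cconv K g₂ := by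
  filter_upwards [hK.ae_convolution_exists (ContinuousLinearMap.mul ℂ ℂ) h₁,
    hK.ae_convolution_exists (ContinuousLinearMap.mul ℂ ℂ) h₂] with x hx₁ hx₂
  exact hx₁.distrib_add hx₂

lemma cconv_add_left {K₁ K₂ g : V → ℂ} (h₁ : Integrable K₁) (h₂ : Integrable K₂)
    (hg : Integrable g) : cconv (K₁ + K₂) g =ᵐ[volume] cconv K₁ g + cconv K₂ g := by
  filter_upwards [h₁.ae_convolution_exists (ContinuousLinearMap.mul ℂ ℂ) hg,
    h₂.ae_convolution_exists (ContinuousLinearMap.mul ℂ ℂ) hg] with x hx₁ hx₂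
  exact hx₁.add_distrib hx₂

/-- Young's inequality `‖K * g‖_p ≤ ‖K‖₁ ‖g‖_p`. -/
lemma eLpNorm_cconv_le {K g : V → ℂ} (hK : AEStronglyMeasurable K) (hg : AEStronglyMeasurable g)
    {p : ℝ≥0∞} (hp : 1 ≤ p) :
    eLpNorm (cconv K g) p volume ≤ eLpNorm K 1 volume * eLpNorm g p volume := by
  rw [eLpNorm_one_eq_lintegral_enorm]
  rcases eq_or_ne p ∞ with rfl | hp'
  · simp only [eLpNorm_exponent_top]
    refine eLpNormEssSup_le_of_ae_enorm_bound (Filter.Eventually.of_forall fun x => ?_)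
    refine (enorm_cconv_le K g x).trans ?_
    rw [← lintegral_mul_const'' _ hK.enorm]
    refine lintegral_mono_ae ?_
    filter_upwards [(quasiMeasurePreserving_sub_left volume x).ae
      (enorm_ae_le_eLpNormEssSup g volume)] with t ht
    gcongr
  · have hp0 : p ≠ 0 := (zero_lt_one.trans_le hp).ne'
    have hp1 : 1 ≤ p.toReal := by
      rw [← ENNReal.toReal_one]; exact ENNReal.toReal_mono hp' hp
    rw [eLpNorm_eq_lintegral_rpow_enorm_toReal hp0 hp',
      eLpNorm_eq_lintegral_rpow_enorm_toReal hp0 hp']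
    calc _ ≤ ((∫⁻ t, ‖K t‖ₑ) ^ p.toReal * ∫⁻ x, ‖g x‖ₑ ^ p.toReal) ^ (1 / p.toReal) := by
          gcongr
          refine le_trans (lintegral_mono fun x => ?_)
            (lintegral_lconvolution_rpow_le hK.enorm hg.enorm hp1)
          gcongr
          exact enorm_cconv_le K g x
      _ = _ := by
          rw [ENNReal.mul_rpow_of_nonneg _ _ (by positivity), ← ENNReal.rpow_mul,
            mul_one_div_cancel (by positivity)]
          simp

lemma fourier_cconv {K g : V → ℂ} (hK : Integrable K) (hg : Integrable g) (ξ : V) :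
    𝓕 (cconv K g) ξ = 𝓕 K ξ * 𝓕 g ξ :=
  Real.fourier_mul_convolution_eq hK hg ξ

lemma eLpNorm_two_fourier (f : 𝓢(V, ℂ)) :
    eLpNorm (𝓕 (f : V → ℂ)) 2 volume = eLpNorm f 2 volume := by
  have h := SchwartzMap.norm_fourier_toL2_eq f
  rw [SchwartzMap.norm_toLp, SchwartzMap.norm_toLp, SchwartzMap.fourier_coe] at h
  have h1 : eLpNorm (𝓕 (f : V → ℂ)) 2 volume ≠ ∞ := by
    rw [← SchwartzMap.fourier_coe]; exact ((𝓕 f).eLpNorm_lt_top 2 volume).ne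
  have h2 : eLpNorm f 2 volume ≠ ∞ := (f.eLpNorm_lt_top 2 volume).ne
  rw [← ENNReal.ofReal_toReal h1, h, ENNReal.ofReal_toReal h2]

lemma eLpNorm_two_cconv_le_schwartz (K g : 𝓢(V, ℂ)) {B : ℝ≥0}
    (hB : ∀ ξ, ‖𝓕 (K : V → ℂ) ξ‖ₑ ≤ B) :
    eLpNorm (cconv K g) 2 volume ≤ B * eLpNorm g 2 volume := by
  have h1 : cconv K g = SchwartzMap.convolution (ContinuousLinearMap.mul ℂ ℂ) K g := by
    ext x; exact (SchwartzMap.convolution_apply (ContinuousLinearMap.mul ℂ ℂ) K g x).symm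
  rw [h1, ← eLpNorm_two_fourier, ← h1, ← eLpNorm_two_fourier g]
  refine eLpNorm_le_nnreal_smul_eLpNorm_of_ae_le_mul (c := B)
    (Filter.Eventually.of_forall fun ξ => ?_) 2
  rw [fourier_cconv K.integrable g.integrable, nnnorm_mul]
  gcongr
  simpa [enorm_eq_nnnorm] using hB ξ

lemma enorm_fourier_le (K : V → ℂ) (ξ : V) : ‖𝓕 K ξ‖ₑ ≤ eLpNorm K 1 volume := by
  rw [Real.fourier_eq, eLpNorm_one_eq_lintegral_enorm]
  refine (enorm_integral_le_lintegral_enorm _).trans (le_of_eq (lintegral_congr fun v => ?_))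
  rw [enorm_eq_nnnorm, enorm_eq_nnnorm, ENNReal.coe_inj]
  exact NNReal.eq (Circle.norm_smul _ _)

lemma exists_schwartz_eLpNorm_sub_le {g : V → ℂ} {p : ℝ≥0∞} (hp : 1 ≤ p) (hp' : p ≠ ∞)
    (hg : MemLp g p volume) {ε : ℝ≥0∞} (hε : ε ≠ 0) :
    ∃ f : 𝓢(V, ℂ), eLpNorm (g - (f : V → ℂ)) p volume ≤ ε := by
  have : Fact (1 ≤ p) := ⟨hp⟩
  obtain ⟨f, hf⟩ := (SchwartzMap.denseRange_toLpCLM (E := V) (F := ℂ) (μ := volume) hp').exists_mem_open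
    (Metric.isOpen_eball (x := hg.toLp g) (ε := ε)) ⟨_, Metric.mem_eball_self (pos_iff_ne_zero.2 hε)⟩
  refine ⟨f, ?_⟩
  have h1 : edist (hg.toLp g) (f.toLp p volume) < ε := by
    rw [edist_comm]; simpa using hf
  rw [Lp.edist_def] at h1
  refine le_trans (le_of_eq (eLpNorm_congr_ae ?_)) h1.le
  filter_upwards [hg.coeFn_toLp, f.coeFn_toLp p volume] with x h2 h3
  simp [h2, h3]

/-- The `L²` bound of a convolution operator by the sup norm of its multiplier. -/
lemma eLpNorm_two_cconv_le {K g : V → ℂ} (hK : Integrable K) (hg : Integrable g)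
    (hg2 : MemLp g 2 volume) {B : ℝ≥0} (hB : ∀ ξ, ‖𝓕 K ξ‖ₑ ≤ B) :
    eLpNorm (cconv K g) 2 volume ≤ B * eLpNorm g 2 volume := by
  obtain ⟨A, hAe⟩ : ∃ A, A = eLpNorm K 1 volume := ⟨_, rfl⟩
  obtain ⟨G, hGe⟩ : ∃ G, G = eLpNorm g 2 volume := ⟨_, rfl⟩
  rw [← hGe]
  have hA : A ≠ ∞ := hAe ▸ (memLp_one_iff_integrable.2 hK).2.ne
  have hG : G ≠ ∞ := hGe ▸ hg2.2.ne
  have key (ε : ℝ≥0) (hε : 0 < ε) :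
      eLpNorm (cconv K g) 2 volume ≤ (ε * G + (A + ε) * ε) + (B + ε) * (G + ε) := by
    have hε' : (ε : ℝ≥0∞) ≠ 0 := by simpa using hε.ne'
    obtain ⟨K', hK'⟩ := exists_schwartz_eLpNorm_sub_le le_rfl (by simp)
      (memLp_one_iff_integrable.2 hK) hε'
    obtain ⟨g', hg'⟩ := exists_schwartz_eLpNorm_sub_le (by norm_num) (by simp) hg2 hε'
    have hKd : Integrable (K - (K' : V → ℂ)) := hK.sub K'.integrable
    have hgd : Integrable (g - (g' : V → ℂ)) := hg.sub g'.integrable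
    have e1 : cconv K g =ᵐ[volume] cconv (K - (K' : V → ℂ)) g + (cconv K' (g - (g' : V → ℂ)) + cconv K' g') := by
      have h1 := cconv_add_left hKd K'.integrable hg
      have h2 := cconv_add_right K'.integrable hgd g'.integrable
      rw [sub_add_cancel] at h1 h2
      filter_upwards [h1, h2] with x hx1 hx2
      rw [hx1, Pi.add_apply, hx2]; rfl
    have hK'A : eLpNorm K' 1 volume ≤ A + ε := by
      have : (K' : V → ℂ) = K - (K - (K' : V → ℂ)) := by simp
      rw [this]
      refine (eLpNorm_sub_le hK.1 hKd.1 le_rfl).trans ?_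
      rw [hAe]; gcongr
    have hg'G : eLpNorm g' 2 volume ≤ G + ε := by
      have : (g' : V → ℂ) = g - (g - (g' : V → ℂ)) := by simp
      rw [this]
      refine (eLpNorm_sub_le hg.1 hgd.1 (by norm_num)).trans ?_
      rw [hGe]; gcongr
    have hB' (ξ : V) : ‖𝓕 (K' : V → ℂ) ξ‖ₑ ≤ (B + ε : ℝ≥0) := by
      rw [ENNReal.coe_add]
      have h3 : 𝓕 (K' : V → ℂ) ξ = 𝓕 K ξ - 𝓕 (K - (K' : V → ℂ)) ξ := by
        have : 𝓕 K = 𝓕 (K - (K' : V → ℂ)) + 𝓕 (K' : V → ℂ) := by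
          conv_lhs => rw [← sub_add_cancel K (K' : V → ℂ)]
          ext ξ
          simp only [Real.fourier_eq, Pi.add_apply, smul_add]
          exact integral_add ((Real.fourierIntegral_convergent_iff _).2 hKd)
            ((Real.fourierIntegral_convergent_iff _).2 K'.integrable)
        rw [this]; simp
      rw [h3]
      refine enorm_sub_le.trans (add_le_add (hB ξ) ((enorm_fourier_le _ _).trans hK'))
    rw [eLpNorm_congr_ae e1]
    refine (eLpNorm_add_le (hKd.cconv hg).1 ((K'.integrable.cconv hgd).add
      (K'.integrable.cconv g'.integrable)).1 (by norm_num)).trans ?_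
    rw [add_assoc]
    refine add_le_add ?_ ((eLpNorm_add_le (K'.integrable.cconv hgd).1
      (K'.integrable.cconv g'.integrable).1 (by norm_num)).trans (add_le_add ?_ ?_))
    · exact (eLpNorm_cconv_le hKd.1 hg.1 (by norm_num)).trans (by rw [hGe]; gcongr)
    · exact (eLpNorm_cconv_le K'.integrable.1 hgd.1 (by norm_num)).trans (by gcongr)
    · exact (eLpNorm_two_cconv_le_schwartz K' g' hB').trans (by rw [ENNReal.coe_add]; gcongr)
  lift A to ℝ≥0 using hA
  lift G to ℝ≥0 using hG
  have hlim : Filter.Tendsto (fun ε : ℝ≥0 => (((ε * G + (A + ε) * ε) + (B + ε) * (G + ε) : ℝ≥0) : ℝ≥0∞))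
      (nhdsWithin 0 (Set.Ioi 0)) (nhds ((B * G : ℝ≥0) : ℝ≥0∞)) := by
    rw [ENNReal.tendsto_coe]
    refine Filter.Tendsto.mono_left (Continuous.tendsto' ?_ _ _ (by simp)) nhdsWithin_le_nhds
    fun_prop
  rw [← ENNReal.coe_mul]
  refine ge_of_tendsto hlim ?_
  filter_upwards [self_mem_nhdsWithin] with ε hε
  exact_mod_cast key ε hε

end Convolution

section Interpolation

lemma setLIntegral_rpow_Ioi_lt {a c s : ℝ} (ha : -1 < a) (hc : 0 < c) (hs : 0 ≤ s) :
    ∫⁻ t in Set.Ioi (0 : ℝ) ∩ {t | c * t < s}, ENNReal.ofReal (t ^ a)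
      = ENNReal.ofReal (c ^ (-(a + 1)) / (a + 1) * s ^ (a + 1)) := by
  have hset : Set.Ioi (0 : ℝ) ∩ {t | c * t < s} = Set.Ioo 0 (s / c) := by
    ext t
    simp only [Set.mem_inter_iff, Set.mem_Ioi, Set.mem_ofPred_eq, Set.mem_Ioo, lt_div_iff₀ hc,
      mul_comm c]
  have hsc : 0 ≤ s / c := by positivity
  have hii := (intervalIntegral.intervalIntegrable_rpow' (a := 0) (b := s / c) ha)
  rw [intervalIntegrable_iff_integrableOn_Ioo_of_le hsc] at hii
  rw [hset, ← ofReal_integral_eq_lintegral_ofReal hii, ← integral_Ioc_eq_integral_Ioo,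
    ← intervalIntegral.integral_of_le hsc, integral_rpow (Or.inl ha),
    Real.zero_rpow (by linarith), Real.div_rpow hs hc.le, Real.rpow_neg hc.le]
  · congr 1; field_simp; ring
  · filter_upwards [ae_restrict_mem measurableSet_Ioo] with t ht
    exact Real.rpow_nonneg ht.1.le _

lemma setLIntegral_rpow_Ioi_ge {a c s : ℝ} (ha : a < -1) (hc : 0 < c) (hs : 0 < s) :
    ∫⁻ t in Set.Ioi (0 : ℝ) ∩ {t | s ≤ c * t}, ENNReal.ofReal (t ^ a)
      = ENNReal.ofReal (c ^ (-(a + 1)) / (-(a + 1)) * s ^ (a + 1)) := by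
  have hsc : 0 < s / c := by positivity
  have hset : Set.Ioi (0 : ℝ) ∩ {t | s ≤ c * t} = Set.Ici (s / c) := by
    ext t
    simp only [Set.mem_inter_iff, Set.mem_Ioi, Set.mem_ofPred_eq, Set.mem_Ici, div_le_iff₀ hc,
      mul_comm c]
    refine ⟨fun h => h.2, fun h => ⟨?_, h⟩⟩
    by_contra! h'
    nlinarith
  rw [hset, setLIntegral_congr Ioi_ae_eq_Ici.symm,
    ← ofReal_integral_eq_lintegral_ofReal (integrableOn_Ioi_rpow_of_lt ha hsc),
    integral_Ioi_rpow_of_lt ha hsc, Real.div_rpow hs.le hc.le, Real.rpow_neg hc.le]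
  · congr 1
    have : a + 1 ≠ 0 := by linarith
    field_simp
  · filter_upwards [ae_restrict_mem measurableSet_Ioi] with t ht
    exact Real.rpow_nonneg (hsc.trans ht).le _

variable {X : Type*} [MeasurableSpace X] {μ : Measure X} [SFinite μ]

/-- Integrating a truncated integral against a weight in the truncation level. -/
lemma lintegral_truncation_swap {f : X → ℝ} (S : ℝ → Set X)
    (hS : MeasurableSet {z : ℝ × X | z.2 ∈ S z.1})
    (hf : Measurable f) (a r : ℝ) :
    ∫⁻ t in Set.Ioi (0 : ℝ), ENNReal.ofReal (t ^ a) * ∫⁻ x in S t, ENNReal.ofReal (f x ^ r) ∂μ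
      = ∫⁻ x, ENNReal.ofReal (f x ^ r) *
          (∫⁻ t in Set.Ioi (0 : ℝ) ∩ {t | x ∈ S t}, ENNReal.ofReal (t ^ a)) ∂μ := by
  have hSt (t : ℝ) : MeasurableSet (S t) := (measurable_prodMk_left (x := t)) hS
  have hSx (x : X) : MeasurableSet {t | x ∈ S t} := (measurable_prodMk_right (y := x)) hS
  have hm1 : Measurable fun t : ℝ => ENNReal.ofReal (t ^ a) := by fun_prop
  have hm2 : Measurable fun x : X => ENNReal.ofReal (f x ^ r) := by fun_prop
  have hF : Measurable (fun z : ℝ × X => {z : ℝ × X | z.2 ∈ S z.1}.indicator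
      (fun z => ENNReal.ofReal (z.1 ^ a) * ENNReal.ofReal (f z.2 ^ r)) z) :=
    ((hm1.comp measurable_fst).mul (hm2.comp measurable_snd)).indicator hS
  have e1 (t : ℝ) : ENNReal.ofReal (t ^ a) * ∫⁻ x in S t, ENNReal.ofReal (f x ^ r) ∂μ
      = ∫⁻ x, {z : ℝ × X | z.2 ∈ S z.1}.indicator
        (fun z => ENNReal.ofReal (z.1 ^ a) * ENNReal.ofReal (f z.2 ^ r)) (t, x) ∂μ := by
    rw [← lintegral_indicator (hSt t), ← lintegral_const_mul _ (hm2.indicator (hSt t))]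
    refine lintegral_congr fun x => ?_
    by_cases hx : x ∈ S t <;> simp [hx]
  have e2 (x : X) : ENNReal.ofReal (f x ^ r) *
          ∫⁻ t in Set.Ioi (0 : ℝ) ∩ {t | x ∈ S t}, ENNReal.ofReal (t ^ a)
      = ∫⁻ t in Set.Ioi (0 : ℝ), {z : ℝ × X | z.2 ∈ S z.1}.indicator
        (fun z => ENNReal.ofReal (z.1 ^ a) * ENNReal.ofReal (f z.2 ^ r)) (t, x) := by
    rw [Set.inter_comm, ← Measure.restrict_restrict (hSx x), ← lintegral_indicator (hSx x),
      ← lintegral_const_mul _ (hm1.indicator (hSx x))]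
    refine lintegral_congr fun t => ?_
    by_cases hx : x ∈ S t <;> simp [hx, mul_comm]
  simp only [e1, e2]
  exact lintegral_lintegral_swap (f := fun t x => {z : ℝ × X | z.2 ∈ S z.1}.indicator
    (fun z => ENNReal.ofReal (z.1 ^ a) * ENNReal.ofReal (f z.2 ^ r)) (t, x)) hF.aemeasurable

lemma lintegral_superlevel {f : X → ℝ} (hf : Measurable f) (hf0 : ∀ x, 0 ≤ f x) {a c r : ℝ}
    (ha : -1 < a) (hr : 0 < r) (hc : 0 < c) :
    ∫⁻ t in Set.Ioi (0 : ℝ), ENNReal.ofReal (t ^ a) *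
        ∫⁻ x in {x | c * t < f x}, ENNReal.ofReal (f x ^ r) ∂μ
      = ENNReal.ofReal (c ^ (-(a + 1)) / (a + 1)) * ∫⁻ x, ENNReal.ofReal (f x ^ (r + (a + 1))) ∂μ := by
  have hS : MeasurableSet {z : ℝ × X | c * z.1 < f z.2} :=
    measurableSet_lt (by fun_prop) (by fun_prop)
  rw [lintegral_truncation_swap (fun t => {x | c * t < f x}) hS hf, ← lintegral_const_mul _ (by fun_prop)]
  refine lintegral_congr fun x => ?_
  have ha' : 0 < a + 1 := by linarith
  have := setLIntegral_rpow_Ioi_lt ha hc (hf0 x)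
  simp only [Set.mem_ofPred_eq] at this ⊢
  rw [this, ← ENNReal.ofReal_mul (Real.rpow_nonneg (hf0 x) _), ← ENNReal.ofReal_mul (by positivity)]
  congr 1
  rw [Real.rpow_add_of_nonneg (hf0 x) hr.le ha'.le]
  ring

lemma lintegral_sublevel {f : X → ℝ} (hf : Measurable f) (hf0 : ∀ x, 0 ≤ f x) {a c r : ℝ}
    (ha : a < -1) (hr : 0 < r) (hra : 0 < r + (a + 1)) (hc : 0 < c) :
    ∫⁻ t in Set.Ioi (0 : ℝ), ENNReal.ofReal (t ^ a) *
        ∫⁻ x in {x | f x ≤ c * t}, ENNReal.ofReal (f x ^ r) ∂μ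
      = ENNReal.ofReal (c ^ (-(a + 1)) / (-(a + 1))) *
          ∫⁻ x, ENNReal.ofReal (f x ^ (r + (a + 1))) ∂μ := by
  have hS : MeasurableSet {z : ℝ × X | f z.2 ≤ c * z.1} :=
    measurableSet_le (by fun_prop) (by fun_prop)
  rw [lintegral_truncation_swap (fun t => {x | f x ≤ c * t}) hS hf, ← lintegral_const_mul _ (by fun_prop)]
  refine lintegral_congr fun x => ?_
  have ha' : 0 < -(a + 1) := by linarith
  rcases (hf0 x).eq_or_lt with h0 | h0
  · simp [← h0, Real.zero_rpow hr.ne', Real.zero_rpow hra.ne']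
  have := setLIntegral_rpow_Ioi_ge ha hc h0
  simp only [Set.mem_ofPred_eq] at this ⊢
  rw [this, ← ENNReal.ofReal_mul (Real.rpow_nonneg (hf0 x) _), ← ENNReal.ofReal_mul (by positivity)]
  congr 1
  rw [Real.rpow_add h0 r]
  ring

/-- Real interpolation between weak-type `(1, 1)` and weak-type `(2, 2)` bounds. -/
lemma lintegral_rpow_le_of_weak_one_two {f F : X → ℝ} (hf : Measurable f) (hf0 : ∀ x, 0 ≤ f x)
    (hF : AEMeasurable F μ) (hF0 : ∀ x, 0 ≤ F x) {p A : ℝ} (hp1 : 1 < p) (hp2 : p < 2) (hA : 0 < A)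
    (h : ∀ t, 0 < t → μ {x | t < F x} ≤
      ENNReal.ofReal (2 * A / t) * ∫⁻ x in {x | A * t < f x}, ENNReal.ofReal (f x ^ (1 : ℝ)) ∂μ +
      ENNReal.ofReal (4 / t ^ 2) * ∫⁻ x in {x | f x ≤ A * t}, ENNReal.ofReal (f x ^ (2 : ℝ)) ∂μ) :
    ∫⁻ x, ENNReal.ofReal (F x ^ p) ∂μ ≤
      ENNReal.ofReal (p * (2 / (p - 1) + 4 / (2 - p)) * A ^ (2 - p)) *
        ∫⁻ x, ENNReal.ofReal (f x ^ p) ∂μ := by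
  have hp0 : 0 < p := by linarith
  have hp1' : 0 < p - 1 := by linarith
  have hp2' : 0 < 2 - p := by linarith
  have hmeas : Measurable fun t : ℝ => ∫⁻ x in {x | A * t < f x}, ENNReal.ofReal (f x ^ (1 : ℝ)) ∂μ := by
    have : (fun t : ℝ => ∫⁻ x in {x | A * t < f x}, ENNReal.ofReal (f x ^ (1 : ℝ)) ∂μ) = fun t =>
        ∫⁻ x, {z : ℝ × X | A * z.1 < f z.2}.indicator
          (fun z => ENNReal.ofReal (f z.2 ^ (1 : ℝ))) (t, x) ∂μ := by
      ext t
      rw [← lintegral_indicator (measurableSet_lt (by fun_prop) (by fun_prop))]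
      rfl
    rw [this]
    refine Measurable.lintegral_prod_right' ?_
    exact Measurable.indicator (by fun_prop) (measurableSet_lt (by fun_prop) (by fun_prop))
  rw [lintegral_rpow_eq_lintegral_meas_lt_mul μ (Filter.Eventually.of_forall hF0) hF hp0]
  calc _ ≤ ENNReal.ofReal p * ∫⁻ t in Set.Ioi (0 : ℝ),
        (ENNReal.ofReal (2 * A) * (ENNReal.ofReal (t ^ (p - 2)) *
          ∫⁻ x in {x | A * t < f x}, ENNReal.ofReal (f x ^ (1 : ℝ)) ∂μ) +
        ENNReal.ofReal 4 * (ENNReal.ofReal (t ^ (p - 3)) *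
          ∫⁻ x in {x | f x ≤ A * t}, ENNReal.ofReal (f x ^ (2 : ℝ)) ∂μ)) := by
        gcongr ENNReal.ofReal p * ?_
        refine setLIntegral_mono' measurableSet_Ioi fun t ht => ?_
        have ht : 0 < t := ht
        refine (mul_le_mul_left (h t ht) _).trans (le_of_eq ?_)
        have e1 : t ^ (p - 2) = t⁻¹ * t ^ (p - 1) := by
          rw [← Real.rpow_neg_one, ← Real.rpow_add ht]; ring_nf
        have e2 : t ^ (p - 3) = (t ^ 2)⁻¹ * t ^ (p - 1) := by
          rw [← Real.rpow_natCast, ← Real.rpow_neg ht.le, ← Real.rpow_add ht]; push_cast; ring_nf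
        rw [e1, e2, div_eq_mul_inv, div_eq_mul_inv,
          ENNReal.ofReal_mul (p := 2 * A) (by positivity), ENNReal.ofReal_mul (p := 4) (by positivity),
          ENNReal.ofReal_mul (p := t⁻¹) (by positivity),
          ENNReal.ofReal_mul (p := (t ^ 2)⁻¹) (by positivity)]
        ring
    _ = ENNReal.ofReal p * (ENNReal.ofReal (2 * A) *
          (ENNReal.ofReal (A ^ (-(p - 2 + 1)) / (p - 2 + 1)) *
            ∫⁻ x, ENNReal.ofReal (f x ^ (1 + (p - 2 + 1))) ∂μ) +
        ENNReal.ofReal 4 * (ENNReal.ofReal (A ^ (-(p - 3 + 1)) / (-(p - 3 + 1))) *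
            ∫⁻ x, ENNReal.ofReal (f x ^ (2 + (p - 3 + 1))) ∂μ)) := by
        rw [lintegral_add_left, lintegral_const_mul' _ _ ENNReal.ofReal_ne_top, lintegral_const_mul' _ _ ENNReal.ofReal_ne_top,
          lintegral_superlevel hf hf0 (by linarith) (by norm_num) hA,
          lintegral_sublevel hf hf0 (by linarith) (by norm_num) (by linarith) hA]
        exact (Measurable.mul (by fun_prop) hmeas).const_mul _
    _ = _ := by
        rw [show 1 + (p - 2 + 1) = p by ring, show 2 + (p - 3 + 1) = p by ring,
          show p - 2 + 1 = p - 1 by ring, show -(p - 3 + 1) = 2 - p by ring,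
          ← mul_assoc, ← mul_assoc (ENNReal.ofReal 4), ← add_mul, ← mul_assoc,
          ← ENNReal.ofReal_mul (by positivity), ← ENNReal.ofReal_mul (by positivity),
          ← ENNReal.ofReal_add (by positivity) (by positivity), ← ENNReal.ofReal_mul (by positivity)]
        congr 2
        have : A ^ (2 - p) = A * A ^ (-(p - 1)) := by
          nth_rewrite 2 [← Real.rpow_one A]
          rw [← Real.rpow_add hA]; ring_nf
        rw [this]; field_simp

/-- Real interpolation between a weak-type `(2, 2)` bound and a bound on `L^∞`. -/
lemma lintegral_rpow_le_of_weak_two_top {f F : X → ℝ} (hf : Measurable f) (hf0 : ∀ x, 0 ≤ f x)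
    (hF : AEMeasurable F μ) (hF0 : ∀ x, 0 ≤ F x) {p c : ℝ} (hp2 : 2 < p) (hc : 0 < c)
    (h : ∀ t, 0 < t → μ {x | t < F x} ≤
      ENNReal.ofReal (4 / t ^ 2) * ∫⁻ x in {x | c * t < f x}, ENNReal.ofReal (f x ^ (2 : ℝ)) ∂μ) :
    ∫⁻ x, ENNReal.ofReal (F x ^ p) ∂μ ≤
      ENNReal.ofReal (p * (4 / (p - 2)) * c ^ (-(p - 2))) *
        ∫⁻ x, ENNReal.ofReal (f x ^ p) ∂μ := by
  have hp0 : 0 < p := by linarith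
  have hp2' : 0 < p - 2 := by linarith
  rw [lintegral_rpow_eq_lintegral_meas_lt_mul μ (Filter.Eventually.of_forall hF0) hF hp0]
  calc _ ≤ ENNReal.ofReal p * ∫⁻ t in Set.Ioi (0 : ℝ),
        ENNReal.ofReal 4 * (ENNReal.ofReal (t ^ (p - 3)) *
          ∫⁻ x in {x | c * t < f x}, ENNReal.ofReal (f x ^ (2 : ℝ)) ∂μ) := by
        gcongr ENNReal.ofReal p * ?_
        refine setLIntegral_mono' measurableSet_Ioi fun t ht => ?_
        have ht : 0 < t := ht
        refine (mul_le_mul_left (h t ht) _).trans (le_of_eq ?_)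
        have e2 : t ^ (p - 3) = (t ^ 2)⁻¹ * t ^ (p - 1) := by
          rw [← Real.rpow_natCast, ← Real.rpow_neg ht.le, ← Real.rpow_add ht]; push_cast; ring_nf
        rw [e2, ENNReal.ofReal_mul (by positivity), div_eq_mul_inv,
          ENNReal.ofReal_mul (by positivity)]
        ring
    _ = ENNReal.ofReal p * (ENNReal.ofReal 4 * (ENNReal.ofReal (c ^ (-(p - 3 + 1)) / (p - 3 + 1)) *
            ∫⁻ x, ENNReal.ofReal (f x ^ (2 + (p - 3 + 1))) ∂μ)) := by
        rw [lintegral_const_mul' _ _ ENNReal.ofReal_ne_top,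
          lintegral_superlevel hf hf0 (by linarith) (by norm_num) hc]
    _ = _ := by
        rw [show 2 + (p - 3 + 1) = p by ring, show p - 3 + 1 = p - 2 by ring,
          ← mul_assoc (ENNReal.ofReal 4), ← mul_assoc,
          ← ENNReal.ofReal_mul (by positivity), ← ENNReal.ofReal_mul (by positivity)]
        congr 2
        field_simp

end Interpolation

section ConvolutionInterpolation

variable {V : Type*} [NormedAddCommGroup V] [InnerProductSpace ℝ V] [FiniteDimensional ℝ V]
  [MeasurableSpace V] [BorelSpace V]

lemma eLpNorm_rpow_eq_lintegral_ofReal {X : Type*} [MeasurableSpace X] {μ : Measure X} {f : X → ℂ}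
    {p : ℝ≥0∞} (hp0 : p ≠ 0) (hp : p ≠ ∞) :
    eLpNorm f p μ = (∫⁻ x, ENNReal.ofReal (‖f x‖ ^ p.toReal) ∂μ) ^ (1 / p.toReal) := by
  rw [eLpNorm_eq_lintegral_rpow_enorm_toReal hp0 hp]
  congr 1
  refine lintegral_congr fun x => ?_
  rw [← ofReal_norm, ENNReal.ofReal_rpow_of_nonneg (norm_nonneg _) ENNReal.toReal_nonneg]

lemma eLpNorm_le_of_lintegral_rpow_le {X : Type*} [MeasurableSpace X] {μ : Measure X} {f F : X → ℂ}
    {p : ℝ≥0∞} (hp0 : p ≠ 0) (hp : p ≠ ∞) {C D e : ℝ} (hC : 0 ≤ C) (hD : 0 < D)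
    (h : ∫⁻ x, ENNReal.ofReal (‖F x‖ ^ p.toReal) ∂μ ≤
      ENNReal.ofReal (C * D ^ (e * p.toReal)) * ∫⁻ x, ENNReal.ofReal (‖f x‖ ^ p.toReal) ∂μ) :
    eLpNorm F p μ ≤ ENNReal.ofReal (C ^ (1 / p.toReal) * D ^ e) * eLpNorm f p μ := by
  have hpp : 0 < p.toReal := ENNReal.toReal_pos hp0 hp
  rw [eLpNorm_rpow_eq_lintegral_ofReal hp0 hp, eLpNorm_rpow_eq_lintegral_ofReal hp0 hp]
  refine (ENNReal.rpow_le_rpow h (by positivity)).trans (le_of_eq ?_)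
  rw [ENNReal.mul_rpow_of_nonneg _ _ (by positivity),
    ENNReal.ofReal_rpow_of_nonneg (by positivity) (by positivity),
    Real.mul_rpow hC (by positivity), ← Real.rpow_mul hD.le, mul_assoc,
    mul_one_div_cancel hpp.ne', mul_one]

lemma measure_norm_gt_le_add {u v w : V → ℂ} (h : u =ᵐ[volume] v + w) (t : ℝ) :
    volume {x | t < ‖u x‖} ≤ volume {x | t / 2 ≤ ‖v x‖} + volume {x | t / 2 < ‖w x‖} := by
  refine le_trans (measure_mono_ae ?_) (measure_union_le _ _)
  filter_upwards [h] with x hx hx'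
  change t < ‖u x‖ at hx'
  rw [hx, Pi.add_apply] at hx'
  change t / 2 ≤ ‖v x‖ ∨ t / 2 < ‖w x‖
  by_contra! hcon
  linarith [norm_add_le (v x) (w x)]

lemma measure_norm_ge_le_one {u : V → ℂ} (hu : AEStronglyMeasurable u) {t : ℝ} (ht : 0 < t) :
    volume {x | t / 2 ≤ ‖u x‖} ≤ ENNReal.ofReal (2 / t) * eLpNorm u 1 volume := by
  rw [eLpNorm_one_eq_lintegral_enorm]
  have h := meas_ge_le_lintegral_div (μ := volume) hu.enorm (ε := ENNReal.ofReal (t / 2))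
    (by simpa using ht) ENNReal.ofReal_ne_top
  have hset : {x | ENNReal.ofReal (t / 2) ≤ ‖u x‖ₑ} = {x | t / 2 ≤ ‖u x‖} := by
    ext x
    rw [Set.mem_ofPred_eq, Set.mem_ofPred_eq, ← ofReal_norm,
      ENNReal.ofReal_le_ofReal_iff (norm_nonneg _)]
  rw [hset] at h
  refine h.trans (le_of_eq ?_)
  rw [ENNReal.div_eq_inv_mul, ← ENNReal.ofReal_inv_of_pos (by positivity), inv_div]

lemma measure_norm_ge_le_two {u : V → ℂ} (hu : AEStronglyMeasurable u) {t : ℝ} (ht : 0 < t) :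
    volume {x | t / 2 ≤ ‖u x‖} ≤ ENNReal.ofReal (4 / t ^ 2) * eLpNorm u 2 volume ^ (2 : ℝ) := by
  have h := meas_ge_le_lintegral_div (μ := volume) (hu.enorm.pow_const (2 : ℝ))
    (ε := ENNReal.ofReal ((t / 2) ^ (2 : ℝ))) (by simpa using by positivity) ENNReal.ofReal_ne_top
  have hset : {x | ENNReal.ofReal ((t / 2) ^ (2 : ℝ)) ≤ ‖u x‖ₑ ^ (2 : ℝ)} = {x | t / 2 ≤ ‖u x‖} := by
    ext x
    rw [Set.mem_ofPred_eq, Set.mem_ofPred_eq, ← ofReal_norm, ENNReal.ofReal_rpow_of_nonneg (norm_nonneg _) (by norm_num),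
      ENNReal.ofReal_le_ofReal_iff (by positivity),
      Real.rpow_le_rpow_iff (by positivity) (norm_nonneg _) (by norm_num)]
  rw [hset] at h
  refine h.trans (le_of_eq ?_)
  rw [ENNReal.div_eq_inv_mul, ← ENNReal.ofReal_inv_of_pos (by positivity),
    eLpNorm_eq_lintegral_rpow_enorm_toReal (by simp) (by simp), ← ENNReal.rpow_mul]
  congr 2
  · norm_num; field_simp; norm_num
  · simp

lemma eLpNorm_one_indicator {g : V → ℂ} {S : Set V} (hS : MeasurableSet S) :
    eLpNorm (S.indicator g) 1 volume = ∫⁻ x in S, ENNReal.ofReal (‖g x‖ ^ (1 : ℝ)) := by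
  rw [eLpNorm_one_eq_lintegral_enorm, ← lintegral_indicator hS]
  refine lintegral_congr fun x => ?_
  by_cases hx : x ∈ S <;> simp [hx]

lemma eLpNorm_two_indicator_sq {g : V → ℂ} {S : Set V} (hS : MeasurableSet S) :
    eLpNorm (S.indicator g) 2 volume ^ (2 : ℝ) = ∫⁻ x in S, ENNReal.ofReal (‖g x‖ ^ (2 : ℝ)) := by
  rw [eLpNorm_rpow_eq_lintegral_ofReal (by simp) (by simp), ← ENNReal.rpow_mul,
    ← lintegral_indicator hS]
  simp only [ENNReal.toReal_ofNat, one_div, isUnit_iff_ne_zero, ne_eq, OfNat.ofNat_ne_zero,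
    not_false_eq_true, IsUnit.inv_mul_cancel, ENNReal.rpow_one]
  refine lintegral_congr fun x => ?_
  by_cases hx : x ∈ S <;> simp [hx]

lemma eLpNorm_cconv_le_of_lt_two {p : ℝ≥0∞} (hp1 : 1 < p.toReal) (hp2 : p.toReal < 2)
    {K : V → ℂ} (hK : Integrable K) {A : ℝ} (hA : 0 < A)
    (hKA : eLpNorm K 1 volume ≤ ENNReal.ofReal A) (hB : ∀ ξ, ‖𝓕 K ξ‖ ≤ 1) (g : 𝓢(V, ℂ)) :
    eLpNorm (cconv K g) p volume ≤
      ENNReal.ofReal ((p.toReal * (2 / (p.toReal - 1) + 4 / (2 - p.toReal))) ^ (1 / p.toReal) *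
        A ^ (2 / p.toReal - 1)) * eLpNorm g p volume := by
  have hp0 : p ≠ 0 := by rintro rfl; simp at hp1; linarith
  have hp : p ≠ ∞ := by rintro rfl; simp at hp1; linarith
  have hgm : Measurable fun x => ‖g x‖ := g.continuous.norm.measurable
  have h1 : 0 < p.toReal - 1 := by linarith
  have h2 : 0 < 2 - p.toReal := by linarith
  refine eLpNorm_le_of_lintegral_rpow_le hp0 hp (by positivity) hA ?_
  rw [show (2 / p.toReal - 1) * p.toReal = 2 - p.toReal by field_simp]
  refine lintegral_rpow_le_of_weak_one_two hgm (fun x => norm_nonneg _)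
    (hK.cconv g.integrable).1.norm.aemeasurable (fun x => norm_nonneg _) hp1 hp2 hA fun t ht => ?_
  set S : Set V := {x | A * t < ‖g x‖}
  have hS : MeasurableSet S := measurableSet_lt measurable_const hgm
  have hSc : Sᶜ = {x | ‖g x‖ ≤ A * t} := by ext x; simp [S]
  have hi1 : Integrable (S.indicator g) := g.integrable.indicator hS
  have hi2 : Integrable (Sᶜ.indicator g) := g.integrable.indicator hS.compl
  have hsplit := cconv_add_right hK hi1 hi2
  rw [Set.indicator_self_add_compl] at hsplit
  refine (measure_norm_gt_le_add hsplit t).trans (add_le_add ?_ ?_)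
  · refine (measure_norm_ge_le_one (hK.cconv hi1).1 ht).trans ?_
    calc _ ≤ ENNReal.ofReal (2 / t) * (ENNReal.ofReal A * eLpNorm (S.indicator g) 1 volume) := by
          gcongr
          exact (eLpNorm_cconv_le hK.1 hi1.1 le_rfl).trans (by gcongr)
      _ = _ := by
          rw [eLpNorm_one_indicator hS, ← mul_assoc, ← ENNReal.ofReal_mul (by positivity)]
          congr 2; ring
  · refine (measure_mono (t := {x | t / 2 ≤ ‖cconv K (Sᶜ.indicator g) x‖})
      fun x hx => by rw [Set.mem_ofPred_eq] at hx ⊢; exact hx.le).trans ((measure_norm_ge_le_two (hK.cconv hi2).1 ht).trans ?_)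
    rw [← hSc, ← eLpNorm_two_indicator_sq hS.compl]
    gcongr
    have := eLpNorm_two_cconv_le (B := 1) hK hi2 ((g.memLp 2).indicator hS.compl)
      (fun ξ => by simpa [← ofReal_norm] using hB ξ)
    simpa using this

lemma eLpNorm_cconv_le_of_two_lt {p : ℝ≥0∞} (hp2 : 2 < p.toReal)
    {K : V → ℂ} (hK : Integrable K) {A : ℝ} (hA : 0 < A)
    (hKA : eLpNorm K 1 volume ≤ ENNReal.ofReal A) (hB : ∀ ξ, ‖𝓕 K ξ‖ ≤ 1) (g : 𝓢(V, ℂ)) :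
    eLpNorm (cconv K g) p volume ≤
      ENNReal.ofReal ((p.toReal * (4 / (p.toReal - 2)) * 2 ^ (p.toReal - 2)) ^ (1 / p.toReal) *
        A ^ (1 - 2 / p.toReal)) * eLpNorm g p volume := by
  have hp0 : p ≠ 0 := by rintro rfl; simp at hp2; linarith
  have hp : p ≠ ∞ := by rintro rfl; simp at hp2; linarith
  have hgm : Measurable fun x => ‖g x‖ := g.continuous.norm.measurable
  have h2 : 0 < p.toReal - 2 := by linarith
  refine eLpNorm_le_of_lintegral_rpow_le hp0 hp (by positivity) hA ?_
  have hc : 0 < 1 / (2 * A) := by positivity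
  rw [show (1 - 2 / p.toReal) * p.toReal = p.toReal - 2 by field_simp]
  have hconst : p.toReal * (4 / (p.toReal - 2)) * 2 ^ (p.toReal - 2) * A ^ (p.toReal - 2)
      = p.toReal * (4 / (p.toReal - 2)) * (1 / (2 * A)) ^ (-(p.toReal - 2)) := by
    rw [one_div, Real.inv_rpow (by positivity), Real.rpow_neg (by positivity), inv_inv,
      Real.mul_rpow (by norm_num) hA.le, mul_assoc]
  rw [hconst]
  refine lintegral_rpow_le_of_weak_two_top hgm (fun x => norm_nonneg _)
    (hK.cconv g.integrable).1.norm.aemeasurable (fun x => norm_nonneg _) hp2 hc fun t ht => ?_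
  set S : Set V := {x | 1 / (2 * A) * t < ‖g x‖}
  have hS : MeasurableSet S := measurableSet_lt measurable_const hgm
  have hi1 : Integrable (S.indicator g) := g.integrable.indicator hS
  have hi2 : Integrable (Sᶜ.indicator g) := g.integrable.indicator hS.compl
  have hsplit := cconv_add_right hK hi1 hi2
  rw [Set.indicator_self_add_compl] at hsplit
  refine (measure_norm_gt_le_add hsplit t).trans ?_
  have hzero : volume {x | t / 2 < ‖cconv K (Sᶜ.indicator g) x‖} = 0 := by
    have hle : eLpNorm (cconv K (Sᶜ.indicator g)) ∞ volume ≤ ENNReal.ofReal (t / 2) := by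
      refine (eLpNorm_cconv_le hK.1 hi2.1 le_top).trans ?_
      have : eLpNorm (Sᶜ.indicator g) ∞ volume ≤ ENNReal.ofReal (1 / (2 * A) * t) := by
        rw [eLpNorm_exponent_top]
        refine eLpNormEssSup_le_of_ae_bound (Filter.Eventually.of_forall fun x => ?_)
        by_cases hx : x ∈ S
        · simp [hx]; positivity
        · rw [Set.indicator_of_mem (by exact hx)]
          exact not_lt.1 hx
      calc _ ≤ ENNReal.ofReal A * ENNReal.ofReal (1 / (2 * A) * t) := by gcongr
        _ = _ := by
          rw [← ENNReal.ofReal_mul hA.le]; congr 1; field_simp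
    rw [eLpNorm_exponent_top] at hle
    have hae := enorm_ae_le_eLpNormEssSup (cconv K (Sᶜ.indicator g)) volume
    rw [← compl_compl {x | t / 2 < ‖cconv K (Sᶜ.indicator g) x‖}, ← mem_ae_iff]
    filter_upwards [hae] with x hx
    have := hx.trans hle
    rw [← ofReal_norm, ENNReal.ofReal_le_ofReal_iff (by positivity)] at this
    simpa using this
  rw [hzero, add_zero]
  refine (measure_norm_ge_le_two (hK.cconv hi1).1 ht).trans ?_
  rw [← eLpNorm_two_indicator_sq hS]
  gcongr
  have := eLpNorm_two_cconv_le (B := 1) hK hi1 ((g.memLp 2).indicator hS)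
    (fun ξ => by simpa [← ofReal_norm] using hB ξ)
  simpa using this

/-- Convolution operators whose kernel has `L¹` norm at most `A` and whose multiplier is bounded by
`1` have norm at most `C A ^ |2 / p - 1|` on `Lᵖ`. -/
theorem exists_eLpNorm_cconv_le (V : Type*) [NormedAddCommGroup V] [InnerProductSpace ℝ V]
    [FiniteDimensional ℝ V] [MeasurableSpace V] [BorelSpace V] {p : ℝ≥0∞} (hp : 1 ≤ p) :
    ∃ C : ℝ, 0 < C ∧ ∀ (K : V → ℂ), Integrable K → ∀ A : ℝ, 0 < A →
      eLpNorm K 1 volume ≤ ENNReal.ofReal A → (∀ ξ, ‖𝓕 K ξ‖ ≤ 1) → ∀ g : 𝓢(V, ℂ),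
        eLpNorm (cconv K g) p volume ≤
          ENNReal.ofReal (C * A ^ (2 * |(p⁻¹).toReal - 1 / 2|)) * eLpNorm g p volume := by
  have hp0 : p ≠ 0 := (zero_lt_one.trans_le hp).ne'
  rcases eq_or_ne p ∞ with rfl | hpt
  · refine ⟨1, one_pos, fun K hK A hA hKA _ g => ?_⟩
    refine (eLpNorm_cconv_le hK.1 g.integrable.1 hp).trans ?_
    rw [ENNReal.inv_top, ENNReal.toReal_zero, zero_sub, abs_neg, abs_of_pos (by norm_num)]
    norm_num
    gcongr
  have hp1 : 1 ≤ p.toReal := by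
    rw [← ENNReal.toReal_one]; exact ENNReal.toReal_mono hpt hp
  rw [ENNReal.toReal_inv]
  rcases hp1.eq_or_lt with h1 | h1
  · refine ⟨1, one_pos, fun K hK A hA hKA _ g => ?_⟩
    refine (eLpNorm_cconv_le hK.1 g.integrable.1 hp).trans ?_
    rw [← h1]
    norm_num
    gcongr
  rcases lt_trichotomy p.toReal 2 with h2 | h2 | h2
  · have h3 : 0 < p.toReal - 1 := by linarith
    have h4 : 0 < 2 - p.toReal := by linarith
    refine ⟨(p.toReal * (2 / (p.toReal - 1) + 4 / (2 - p.toReal))) ^ (1 / p.toReal), ?_,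
      fun K hK A hA hKA hB g => (eLpNorm_cconv_le_of_lt_two h1 h2 hK hA hKA hB g).trans (le_of_eq ?_)⟩
    · positivity
    · have : 0 ≤ p.toReal⁻¹ - 1 / 2 := by
        rw [sub_nonneg, one_div]; exact inv_anti₀ (by linarith) h2.le
      rw [abs_of_nonneg this, show 2 / p.toReal - 1 = 2 * (p.toReal⁻¹ - 1 / 2) by ring]
  · refine ⟨1, one_pos, fun K hK A hA hKA hB g => ?_⟩
    have hp2 : p = 2 := by
      rw [← ENNReal.ofReal_toReal hpt, h2]; simp
    subst hp2
    have := eLpNorm_two_cconv_le (B := 1) hK g.integrable (g.memLp 2)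
      (fun ξ => by simpa [← ofReal_norm] using hB ξ)
    simpa using this
  · have h4 : 0 < p.toReal - 2 := by linarith
    refine ⟨(p.toReal * (4 / (p.toReal - 2)) * 2 ^ (p.toReal - 2)) ^ (1 / p.toReal), ?_,
      fun K hK A hA hKA hB g => (eLpNorm_cconv_le_of_two_lt h2 hK hA hKA hB g).trans (le_of_eq ?_)⟩
    · positivity
    · have : p.toReal⁻¹ - 1 / 2 ≤ 0 := by
        rw [sub_nonpos, one_div]; exact inv_anti₀ (by norm_num) h2.le
      rw [abs_of_nonpos this, show 1 - 2 / p.toReal = 2 * -(p.toReal⁻¹ - 1 / 2) by ring]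

end ConvolutionInterpolation

section WienerAlgebra

variable {V : Type*} [NormedAddCommGroup V] [InnerProductSpace ℝ V] [FiniteDimensional ℝ V]
  [MeasurableSpace V] [BorelSpace V]

/-- `m` is the Fourier transform of an integrable function of `L¹` norm at most `A`. -/
def IsWiener (m : V → ℂ) (A : ℝ≥0∞) : Prop :=
  ∃ K : V → ℂ, Integrable K ∧ 𝓕 K = m ∧ eLpNorm K 1 volume ≤ A

lemma IsWiener.mono {m : V → ℂ} {A B : ℝ≥0∞} (h : IsWiener m A) (hAB : A ≤ B) : IsWiener m B := by
  obtain ⟨K, h1, h2, h3⟩ := h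
  exact ⟨K, h1, h2, h3.trans hAB⟩

lemma isWiener_schwartz (m : 𝓢(V, ℂ)) :
    IsWiener m (eLpNorm (𝓕⁻ m : 𝓢(V, ℂ)) 1 volume) := by
  refine ⟨(𝓕⁻ m : 𝓢(V, ℂ)), (𝓕⁻ m).integrable, ?_, le_rfl⟩
  rw [← SchwartzMap.fourier_coe, FourierTransform.fourier_fourierInv_eq]

lemma IsWiener.mul {m₁ m₂ : V → ℂ} {A B : ℝ≥0∞} (h₁ : IsWiener m₁ A) (h₂ : IsWiener m₂ B) :
    IsWiener (fun ξ => m₁ ξ * m₂ ξ) (A * B) := by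
  obtain ⟨K₁, hK₁, rfl, hA⟩ := h₁
  obtain ⟨K₂, hK₂, rfl, hB⟩ := h₂
  refine ⟨cconv K₁ K₂, hK₁.cconv hK₂, funext fun ξ => fourier_cconv hK₁ hK₂ ξ, ?_⟩
  exact (eLpNorm_cconv_le hK₁.1 hK₂.1 le_rfl).trans (by gcongr)

lemma IsWiener.const_mul {m : V → ℂ} {A : ℝ≥0∞} (h : IsWiener m A) (c : ℂ) :
    IsWiener (fun ξ => c * m ξ) (‖c‖ₑ * A) := by
  obtain ⟨K, hK, rfl, hA⟩ := h
  refine ⟨c • K, hK.smul c, funext fun ξ => ?_, ?_⟩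
  · simp only [Real.fourier_eq, Pi.smul_apply]
    rw [← smul_eq_mul, ← integral_smul]
    congr 1; ext x; exact smul_comm _ _ _
  · rw [eLpNorm_const_smul]; gcongr

lemma IsWiener.comp_sub {m : V → ℂ} {A : ℝ≥0∞} (h : IsWiener m A) (a : V) :
    IsWiener (fun ξ => m (ξ - a)) A := by
  obtain ⟨K, hK, rfl, hA⟩ := h
  refine ⟨fun x => Real.fourierChar (inner ℝ x a) • K x, ?_, funext fun ξ => ?_, le_trans (le_of_eq ?_) hA⟩
  · simpa using (Real.fourierIntegral_convergent_iff (f := K) (-a)).2 hK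
  · simp only [Real.fourier_eq]
    congr 1; ext x
    rw [smul_smul, ← AddChar.map_add_eq_mul, inner_sub_right]
    congr 2; ring
  · refine eLpNorm_congr_norm_ae (Filter.Eventually.of_forall fun x => ?_)
    exact Circle.norm_smul _ _

lemma IsWiener.fourierChar_mul {m : V → ℂ} {A : ℝ≥0∞} (h : IsWiener m A) (b : V) :
    IsWiener (fun ξ => (Real.fourierChar (inner ℝ b ξ) : ℂ) * m ξ) A := by
  obtain ⟨K, hK, rfl, hA⟩ := h
  refine ⟨fun x => K (x + b), hK.comp_add_right b, funext fun ξ => ?_, le_trans (le_of_eq ?_) hA⟩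
  · simp only [Real.fourier_eq]
    rw [← integral_add_right_eq_self (fun v => Real.fourierChar (-inner ℝ v ξ) • K v) b,
      ← integral_const_mul]
    congr 1; ext x
    rw [inner_add_left, neg_add, AddChar.map_add_eq_mul, Circle.smul_def, Circle.smul_def,
      smul_eq_mul, smul_eq_mul, Circle.coe_mul, ← mul_assoc, mul_left_comm, ← Circle.coe_mul,
      ← AddChar.map_add_eq_mul]
    simp
  · exact eLpNorm_comp_measurePreserving hK.1 (measurePreserving_add_right volume b)

lemma IsWiener.comp_smul {m : V → ℂ} {A : ℝ≥0∞} (h : IsWiener m A) {c : ℝ} (hc : 0 < c) :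
    IsWiener (fun ξ => m (c • ξ)) A := by
  obtain ⟨K, hK, rfl, hA⟩ := h
  set n := Module.finrank ℝ V
  have hint : Integrable fun x => K (c⁻¹ • x) := (integrable_comp_smul_iff volume K (by positivity)).2 hK
  have hint' : Integrable fun x => (c ^ n)⁻¹ • K (c⁻¹ • x) := hint.smul (c ^ n)⁻¹
  refine ⟨fun x => (c ^ n)⁻¹ • K (c⁻¹ • x), hint', funext fun ξ => ?_, le_trans (le_of_eq ?_) hA⟩
  · simp only [Real.fourier_eq]
    have := Measure.integral_comp_inv_smul volume
      (fun x : V => Real.fourierChar (-inner ℝ x (c • ξ)) • K x) c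
    rw [abs_of_pos (by positivity)] at this
    rw [← inv_smul_smul₀ (show c ^ n ≠ 0 by positivity)
      (∫ x : V, Real.fourierChar (-inner ℝ x (c • ξ)) • K x), ← this, ← integral_smul]
    congr 1; ext x
    rw [smul_comm, inner_smul_left, inner_smul_right]
    simp [hc.ne']
  · rw [eLpNorm_one_eq_lintegral_enorm, eLpNorm_one_eq_lintegral_enorm,
      ← ofReal_integral_norm_eq_lintegral_enorm hint',
      ← ofReal_integral_norm_eq_lintegral_enorm hK]
    simp only [norm_smul]
    rw [integral_const_mul, Measure.integral_comp_inv_smul volume (fun x : V => ‖K x‖) c]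
    congr 1
    rw [abs_of_pos (by positivity), smul_eq_mul, Real.norm_eq_abs, abs_of_pos (by positivity),
      inv_mul_cancel_left₀ (by positivity)]

lemma IsWiener.tsum {m : ℕ → V → ℂ} {A : ℕ → ℝ≥0∞} (h : ∀ j, IsWiener (m j) (A j))
    (hA : ∑' j, A j ≠ ∞) : IsWiener (fun ξ => ∑' j, m j ξ) (∑' j, A j) := by
  choose K hK hKm hKA using h
  have hle : ∑' j, ∫⁻ x, ‖K j x‖ₑ ≤ ∑' j, A j := by
    refine ENNReal.tsum_le_tsum fun j => ?_
    rw [← eLpNorm_one_eq_lintegral_enorm]; exact hKA j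
  have hfin : ∫⁻ x, ∑' j, ‖K j x‖ₑ ≠ ∞ := by
    rw [lintegral_tsum fun j => (hK j).1.enorm]
    exact ne_top_of_le_ne_top hA hle
  have hsum : ∀ᵐ x, Summable fun j => K j x := by
    filter_upwards [ae_lt_top' (AEMeasurable.tsum fun j => (hK j).1.enorm) hfin] with x hx
    refine Summable.of_nnnorm ?_
    rw [← ENNReal.tsum_coe_ne_top_iff_summable]
    exact hx.ne
  have hmeas : AEStronglyMeasurable (fun x => ∑' j, K j x) volume := by
    refine aestronglyMeasurable_of_tendsto_ae Filter.atTop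
      (f := fun N x => ∑ j ∈ Finset.range N, K j x) (fun N => ?_) ?_
    · exact Finset.aestronglyMeasurable_fun_sum _ fun j _ => (hK j).1
    · filter_upwards [hsum] with x hx using hx.hasSum.tendsto_sum_nat
  have hbd : ∫⁻ x, ‖∑' j, K j x‖ₑ ≤ ∑' j, A j := by
    refine (lintegral_mono fun x => enorm_tsum_le_tsum_enorm).trans ?_
    rw [lintegral_tsum fun j => (hK j).1.enorm]
    exact hle
  refine ⟨fun x => ∑' j, K j x, ⟨hmeas, lt_of_le_of_lt hbd hA.lt_top⟩, funext fun ξ => ?_, ?_⟩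
  · rw [Real.fourier_eq]
    have hiF (j : ℕ) : Integrable fun x => Real.fourierChar (-inner ℝ x ξ) • K j x :=
      (Real.fourierIntegral_convergent_iff ξ).2 (hK j)
    have := integral_tsum (μ := volume)
      (f := fun j x => Real.fourierChar (-inner ℝ x ξ) • K j x) (fun j => (hiF j).1) (by
        refine ne_top_of_le_ne_top hA (le_trans (le_of_eq ?_) hle)
        refine tsum_congr fun j => lintegral_congr fun x => ?_
        rw [← ofReal_norm, Circle.norm_smul, ofReal_norm])
    simp only [← hKm, Real.fourier_eq]
    rw [← this]
    refine integral_congr_ae ?_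
    filter_upwards [hsum] with x hx
    exact (hx.tsum_const_smul _).symm
  · rw [eLpNorm_one_eq_lintegral_enorm]; exact hbd

lemma IsWiener.mul_pow {θ ψ : V → ℂ} {A B : ℝ≥0∞} (hθ : IsWiener θ A) (hψ : IsWiener ψ B) (j : ℕ) :
    IsWiener (fun ξ => θ ξ * ψ ξ ^ j) (A * B ^ j) := by
  induction j with
  | zero => simpa using hθ
  | succ j ih =>
    convert! ih.mul hψ using 1
    · ext ξ; ring
    · ring

/-- The Wiener algebra is closed under composition with the exponential. -/
lemma IsWiener.mul_exp {θ ψ : V → ℂ} {A B : ℝ≥0∞} (hθ : IsWiener θ A) (hψ : IsWiener ψ B)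
    (hA : A ≠ ∞) (hB : B ≠ ∞) :
    ∃ D : ℝ≥0∞, D ≠ ∞ ∧ IsWiener (fun ξ => θ ξ * Complex.exp (Complex.I * ψ ξ)) D := by
  have hterm (j : ℕ) := (hθ.mul_pow hψ j).const_mul (Complex.I ^ j / (j.factorial : ℂ))
  have hsum : ∑' j : ℕ, ‖Complex.I ^ j / (j.factorial : ℂ)‖ₑ * (A * B ^ j) ≠ ∞ := by
    lift A to ℝ≥0 using hA
    lift B to ℝ≥0 using hB
    have : (fun j : ℕ => ‖Complex.I ^ j / (j.factorial : ℂ)‖ₑ * (A * (B : ℝ≥0∞) ^ j)) =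
        fun j : ℕ => ((‖Complex.I ^ j / (j.factorial : ℂ)‖₊ * (A * B ^ j) : ℝ≥0) : ℝ≥0∞) := by
      ext j; push_cast; rfl
    rw [this, ENNReal.tsum_coe_ne_top_iff_summable, ← NNReal.summable_coe]
    convert! (Real.summable_pow_div_factorial B).mul_left (A : ℝ) using 1
    ext j
    simp
    ring
  refine ⟨_, hsum, ?_⟩
  convert! IsWiener.tsum hterm hsum using 1
  ext ξ
  rw [Complex.exp_eq_exp_ℂ, NormedSpace.exp_eq_tsum_div, ← tsum_mul_left]
  refine tsum_congr fun j => ?_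
  rw [_root_.mul_pow]; ring

lemma contDiff_norm_rpow_mul_of_eq_zero {V : Type*} [NormedAddCommGroup V] [InnerProductSpace ℝ V]
    {α r : ℝ} (hr : 0 < r) {β : V → ℝ} (hβ : ContDiff ℝ (⊤ : ℕ∞) β)
    (h0 : ∀ ξ, ‖ξ‖ < r → β ξ = 0) : ContDiff ℝ (⊤ : ℕ∞) fun ξ : V => ‖ξ‖ ^ α * β ξ := by
  rw [contDiff_iff_contDiffAt]
  intro ξ
  by_cases hξ : ξ = 0
  · have : (fun ξ : V => ‖ξ‖ ^ α * β ξ) =ᶠ[nhds ξ] fun _ => 0 := by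
      filter_upwards [Metric.ball_mem_nhds ξ hr] with η hη
      rw [h0 η (by simpa [hξ] using hη), mul_zero]
    exact contDiffAt_const.congr_of_eventuallyEq this
  · exact ((contDiffAt_norm ℝ hξ).rpow_const_of_ne (by simpa using hξ)).mul
      hβ.contDiffAt

/-- A compactly supported cut-off of `|ξ| ^ α`, `α > 0`, is in the Wiener algebra. -/
lemma isWiener_norm_rpow_mul {α : ℝ} (hα : 0 < α) (θ : ContDiffBump (0 : V)) :
    ∃ D : ℝ≥0∞, D ≠ ∞ ∧ IsWiener (fun ξ => ((‖ξ‖ ^ α * θ ξ : ℝ) : ℂ)) D := by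
  set β : V → ℝ := fun ξ => θ ξ - θ ((2 : ℝ) • ξ) with hβ
  have hsm : ContDiff ℝ (⊤ : ℕ∞) fun ξ : V => ‖ξ‖ ^ α * β ξ := by
    refine contDiff_norm_rpow_mul_of_eq_zero (r := θ.rIn / 2) (by have := θ.rIn_pos; linarith) ?_
      fun ξ hξ => ?_
    · exact θ.contDiff.sub (θ.contDiff.comp (contDiff_const_smul (2 : ℝ)))
    · rw [hβ]
      dsimp only
      rw [θ.one_of_mem_closedBall, θ.one_of_mem_closedBall, sub_self]
      · simp [norm_smul]; linarith
      · have := θ.rIn_pos; simp; linarith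
  have hcs : HasCompactSupport fun ξ : V => ‖ξ‖ ^ α * β ξ := by
    refine HasCompactSupport.mul_left (HasCompactSupport.sub θ.hasCompactSupport ?_)
    exact θ.hasCompactSupport.comp_smul (by norm_num)
  have hsm' : ContDiff ℝ (⊤ : ℕ∞) fun ξ : V => ((‖ξ‖ ^ α * β ξ : ℝ) : ℂ) :=
    Complex.ofRealCLM.contDiff.comp hsm
  have hcs' : HasCompactSupport fun ξ : V => ((‖ξ‖ ^ α * β ξ : ℝ) : ℂ) :=
    hcs.comp_left (g := fun t : ℝ => (t : ℂ)) (by simp)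
  set g : 𝓢(V, ℂ) := hcs'.toSchwartzMap hsm'
  have hg := isWiener_schwartz g
  set D := eLpNorm (𝓕⁻ g : 𝓢(V, ℂ)) 1 volume
  have hD : D ≠ ∞ := ((𝓕⁻ g).eLpNorm_lt_top 1 volume).ne
  have hterm (j : ℕ) := (hg.comp_smul (c := (2 : ℝ) ^ j) (by positivity)).const_mul
    (((2 : ℝ) ^ (-α)) ^ j : ℝ)
  have hq0 : (0 : ℝ) < 2 ^ (-α) := by positivity
  have hq : (2 : ℝ) ^ (-α) < 1 := Real.rpow_lt_one_of_one_lt_of_neg (by norm_num) (by linarith)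
  have hsum : ∑' j : ℕ, ‖((((2 : ℝ) ^ (-α)) ^ j : ℝ) : ℂ)‖ₑ * D ≠ ∞ := by
    rw [ENNReal.tsum_mul_right]
    refine ENNReal.mul_ne_top ?_ hD
    have : (fun j : ℕ => ‖((((2 : ℝ) ^ (-α)) ^ j : ℝ) : ℂ)‖ₑ) =
        fun j : ℕ => ENNReal.ofReal (((2 : ℝ) ^ (-α)) ^ j) := by
      ext j
      rw [← ofReal_norm, Complex.norm_real, Real.norm_eq_abs, abs_of_pos (by positivity)]
    rw [this, ← ENNReal.ofReal_tsum_of_nonneg (fun j => by positivity)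
      (summable_geometric_of_lt_one hq0.le hq)]
    exact ENNReal.ofReal_ne_top
  refine ⟨_, hsum, ?_⟩
  convert! IsWiener.tsum hterm hsum using 1
  ext ξ
  have hgj (j : ℕ) : ((((2 : ℝ) ^ (-α)) ^ j : ℝ) : ℂ) * g ((2 : ℝ) ^ j • ξ) =
      ((‖ξ‖ ^ α * (θ ((2 : ℝ) ^ j • ξ) - θ ((2 : ℝ) ^ (j + 1) • ξ)) : ℝ) : ℂ) := by
    change _ * (((‖(2 : ℝ) ^ j • ξ‖ ^ α * β ((2 : ℝ) ^ j • ξ) : ℝ)) : ℂ) = _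
    rw [← Complex.ofReal_mul]
    congr 1
    rw [norm_smul, Real.mul_rpow (norm_nonneg _) (norm_nonneg _), Real.norm_eq_abs,
      abs_of_pos (by positivity), ← Real.rpow_natCast, ← Real.rpow_natCast, ← Real.rpow_mul (by norm_num),
      ← Real.rpow_mul (by norm_num), ← mul_assoc, ← mul_assoc, ← Real.rpow_add (by norm_num)]
    rw [show -α * (j : ℝ) + j * α = 0 by ring, Real.rpow_zero, one_mul, hβ]
    dsimp only
    rw [smul_smul, pow_succ', Real.rpow_natCast]
  simp only [hgj]
  by_cases hξ : ξ = 0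
  · simp [hξ, Real.zero_rpow hα.ne']
  obtain ⟨J, hJ⟩ : ∃ J : ℕ, ∀ j ≥ J, θ ((2 : ℝ) ^ j • ξ) = 0 := by
    obtain ⟨J, hJ⟩ := pow_unbounded_of_one_lt (θ.rOut / ‖ξ‖) (one_lt_two (α := ℝ))
    refine ⟨J, fun j hj => θ.zero_of_le_dist ?_⟩
    rw [dist_zero_right, norm_smul, Real.norm_eq_abs, abs_of_pos (by positivity)]
    rw [div_lt_iff₀ (by positivity)] at hJ
    refine hJ.le.trans ?_
    gcongr
    norm_num
  rw [tsum_eq_sum (s := Finset.range J)]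
  · rw [← Complex.ofReal_sum, ← Finset.mul_sum,
      Finset.sum_range_sub' (fun j => θ ((2 : ℝ) ^ j • ξ)) J, hJ J le_rfl]
    simp
  · intro j hj
    have hj : J ≤ j := by simpa using hj
    rw [hJ j hj, hJ (j + 1) (by omega)]; simp

/-- Applying a multiplier from the Wiener algebra is convolution with its kernel. -/
lemma fourierInv_mul_fourier_eq_cconv {K : V → ℂ} (hK : Integrable K) (g : 𝓢(V, ℂ)) :
    𝓕⁻ (fun ξ => 𝓕 K ξ * 𝓕 (g : V → ℂ) ξ) = cconv K g := by
  have hcont : Continuous (cconv K g) := by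
    refine BddAbove.continuous_convolution_right_of_integrable _ ?_ hK g.continuous
    obtain ⟨C, hC⟩ := g.decay 0 0
    exact ⟨C, by rintro _ ⟨x, rfl⟩; simpa using hC.2 x⟩
  have h1 : (fun ξ => 𝓕 K ξ * 𝓕 (g : V → ℂ) ξ) = 𝓕 (cconv K g) :=
    funext fun ξ => (fourier_cconv hK g.integrable ξ).symm
  have hint : Integrable (fun ξ => 𝓕 K ξ * 𝓕 (g : V → ℂ) ξ) := by
    refine Integrable.bdd_mul (c := ∫ x, ‖K x‖) ?_ ?_ (Filter.Eventually.of_forall fun ξ => ?_)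
    · exact (𝓕 g).integrable
    · exact (VectorFourier.fourierIntegral_continuous Real.continuous_fourierChar
        (L := innerₗ V) (by exact continuous_inner) hK).aestronglyMeasurable
    · rw [Real.fourier_eq]
      refine (norm_integral_le_integral_norm _).trans (le_of_eq ?_)
      simp only [Circle.norm_smul]
  rw [h1] at hint ⊢
  exact hcont.fourierInv_fourier_eq (hK.cconv g.integrable) hint

end WienerAlgebra

section KernelBound

variable {V : Type*} [NormedAddCommGroup V] [InnerProductSpace ℝ V] [FiniteDimensional ℝ V]
  [MeasurableSpace V] [BorelSpace V]

lemma one_add_norm_pow_le {V ι : Type*} [NormedAddCommGroup V] [InnerProductSpace ℝ V] [Fintype ι]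
    (b : OrthonormalBasis ι ℝ V) (y : V) (N : ℕ) :
    (1 + ‖y‖) ^ N ≤ (1 + Fintype.card ι : ℝ) ^ N * (1 + ∑ i, |inner ℝ y (b i)| ^ N) := by
  have hy : ‖y‖ ≤ ∑ i, |inner ℝ y (b i)| := by
    conv_lhs => rw [← b.sum_repr' y]
    refine (norm_sum_le _ _).trans (le_of_eq (Finset.sum_congr rfl fun i _ => ?_))
    rw [norm_smul, b.norm_eq_one, mul_one, Real.norm_eq_abs, real_inner_comm]
  have hs0 : 0 ≤ ∑ i, |inner ℝ y (b i)| ^ N := Finset.sum_nonneg fun i _ => by positivity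
  obtain ⟨M, hM1, hM, hMN⟩ : ∃ M : ℝ, 1 ≤ M ∧ (∀ i, |inner ℝ y (b i)| ≤ M) ∧
      M ^ N ≤ 1 + ∑ i, |inner ℝ y (b i)| ^ N := by
    by_cases h : ∀ i, |inner ℝ y (b i)| ≤ 1
    · exact ⟨1, le_rfl, h, by simpa using hs0⟩
    · push Not at h
      obtain ⟨i₀, hi₀⟩ := h
      obtain ⟨i, -, hi⟩ := Finset.exists_max_image Finset.univ (fun i => |inner ℝ y (b i)|)
        ⟨i₀, Finset.mem_univ _⟩
      refine ⟨|inner ℝ y (b i)|, hi₀.le.trans (hi i₀ (Finset.mem_univ _)),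
        fun j => hi j (Finset.mem_univ _), ?_⟩
      have := Finset.single_le_sum (f := fun i => |inner ℝ y (b i)| ^ N)
        (fun i _ => by positivity) (Finset.mem_univ i)
      linarith
  have hsum : ∑ i, |inner ℝ y (b i)| ≤ Fintype.card ι * M := by
    refine (Finset.sum_le_card_nsmul _ _ M fun i _ => hM i).trans (by simp)
  calc (1 + ‖y‖) ^ N ≤ ((1 + Fintype.card ι : ℝ) * M) ^ N := by
        gcongr; linarith
    _ = (1 + Fintype.card ι : ℝ) ^ N * M ^ N := mul_pow _ _ _
    _ ≤ _ := by gcongr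

open LineDeriv in
lemma norm_fourierInv_iterate_lineDeriv (G : 𝓢(V, ℂ)) (e : V) (k : ℕ) (x : V) :
    ‖𝓕⁻ (∂_{e}^[k] G) x‖ = (2 * Real.pi * |inner ℝ x e|) ^ k * ‖𝓕⁻ G x‖ := by
  induction k with
  | zero => simp
  | succ k ih =>
    have hg : (inner ℝ · e : V → ℝ).HasTemperateGrowth := by fun_prop
    rw [Function.iterate_succ_apply', SchwartzMap.fourierInv_lineDerivOp_eq,
      smul_apply, SchwartzMap.smulLeftCLM_apply_apply hg, norm_smul, norm_smul, ih]
    simp [abs_of_pos Real.pi_pos]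
    ring

open LineDeriv in
lemma norm_iterate_lineDeriv_le {V : Type*} [NormedAddCommGroup V] [InnerProductSpace ℝ V]
    (G : 𝓢(V, ℂ)) {e : V} (he : ‖e‖ = 1) (k : ℕ) (x : V) :
    ‖(∂_{e}^[k] G) x‖ ≤ ‖iteratedFDeriv ℝ k G x‖ := by
  rw [← iteratedLineDerivOp_const_eq_iter_lineDerivOp, SchwartzMap.iteratedLineDerivOp_eq_iteratedFDeriv]
  refine (ContinuousMultilinearMap.le_opNorm _ _).trans ?_
  simp [he]

lemma eLpNorm_two_comp_smul {f : V → ℝ} (hf : Measurable f) {R : ℝ} (hR : 0 < R) :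
    eLpNorm (fun x => f (R⁻¹ • x)) 2 volume =
      ENNReal.ofReal (R ^ ((Module.finrank ℝ V : ℝ) / 2)) * eLpNorm f 2 volume := by
  have hR' : R⁻¹ ≠ 0 := by positivity
  have h1 : eLpNorm (fun x => f (R⁻¹ • x)) 2 volume =
      eLpNorm f 2 (Measure.map (fun x : V => R⁻¹ • x) volume) :=
    (eLpNorm_map_measure hf.aestronglyMeasurable (by fun_prop)).symm
  have hc : ENNReal.ofReal |(R⁻¹ ^ Module.finrank ℝ V)⁻¹| ≠ 0 := by
    rw [abs_of_pos (by positivity)]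
    exact (ENNReal.ofReal_pos.2 (by positivity)).ne'
  rw [h1, Measure.map_addHaar_smul volume hR', eLpNorm_smul_measure_of_ne_zero hc, smul_eq_mul]
  congr 1
  rw [abs_of_pos (by positivity), ENNReal.ofReal_rpow_of_pos (by positivity), inv_pow, inv_inv,
    ← Real.rpow_natCast, ← Real.rpow_mul hR.le]
  congr 2
  simp
  ring

lemma eLpNorm_two_le_of_support_subset {f : V → ℂ} {M r : ℝ}
    (hf : ∀ x, ‖f x‖ ≤ M) (hs : Function.support f ⊆ Metric.closedBall 0 r) :
    eLpNorm f 2 volume ≤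
      volume (Metric.closedBall (0 : V) r) ^ (2⁻¹ : ℝ) * ENNReal.ofReal M := by
  rw [← eLpNorm_restrict_eq_of_support_subset hs]
  refine (eLpNorm_le_of_ae_bound (Filter.Eventually.of_forall hf)).trans (le_of_eq ?_)
  simp

open LineDeriv in
/-- The `L¹` norm of the inverse Fourier transform of a function supported in a fixed ball whose
derivatives of order `j` are `O(Rʲ)` is `O(R^{n/2})`. -/
lemma exists_eLpNorm_fourierInv_le (V : Type*) [NormedAddCommGroup V] [InnerProductSpace ℝ V]
    [FiniteDimensional ℝ V] [MeasurableSpace V] [BorelSpace V] (r : ℝ) :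
    ∃ C : ℝ≥0∞, C ≠ ∞ ∧ ∀ (G : 𝓢(V, ℂ)) (B R : ℝ), 1 ≤ R →
      tsupport G ⊆ Metric.closedBall 0 r →
      (∀ j ≤ Module.finrank ℝ V + 1, ∀ x, ‖iteratedFDeriv ℝ j G x‖ ≤ B * R ^ j) →
      eLpNorm (𝓕⁻ G : 𝓢(V, ℂ)) 1 volume ≤
        C * ENNReal.ofReal (B * R ^ ((Module.finrank ℝ V : ℝ) / 2)) := by
  set n := Module.finrank ℝ V with hn
  set N := n + 1 with hN
  set φ : V → ℝ := fun x => ((1 + ‖x‖) ^ N)⁻¹ with hφ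
  have hφm : Measurable φ := by fun_prop
  have hφ2 : eLpNorm φ 2 volume ≠ ∞ := by
    have : MemLp φ 2 volume := by
      rw [memLp_two_iff_integrable_sq hφm.aestronglyMeasurable]
      convert! integrable_one_add_norm (E := V) (μ := volume) (r := (2 * N : ℕ)) ?_ using 1
      · ext x
        rw [Real.rpow_neg (by positivity), Real.rpow_natCast, hφ]
        dsimp only
        rw [inv_pow, ← pow_mul, mul_comm]
      · rw [← hn, hN]; push_cast; linarith [(Nat.cast_nonneg n : (0 : ℝ) ≤ n)]
    exact this.2.ne
  set vol := volume (Metric.closedBall (0 : V) r) ^ (2⁻¹ : ℝ)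
  have hvol : vol ≠ ∞ :=
    ENNReal.rpow_ne_top_of_nonneg (by norm_num) (isCompact_closedBall _ _).measure_lt_top.ne
  refine ⟨eLpNorm φ 2 volume * (ENNReal.ofReal ((1 + n : ℝ) ^ N) * (vol + n * vol)), by finiteness,
    fun G B R hR hG hB => ?_⟩
  have hR0 : 0 < R := by linarith
  set b := stdOrthonormalBasis ℝ V
  set H : Fin n → 𝓢(V, ℂ) := fun i => 𝓕⁻ (∂_{b i}^[N] G) with hH
  have hB0 : 0 ≤ B := by simpa using (norm_nonneg _).trans (hB 0 (by omega) 0)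
  -- the weighted pointwise bound
  set P : V → ℝ := (1 + n : ℝ) ^ N • ((fun x => ‖𝓕⁻ G x‖) + ∑ i, (R ^ N)⁻¹ • fun x => ‖H i x‖) with hP
  have hpt (x : V) : ‖((φ (R⁻¹ • x))⁻¹ : ℝ) • 𝓕⁻ G x‖ ≤ P x := by
    have h1 := one_add_norm_pow_le b (R⁻¹ • x) N
    rw [Fintype.card_fin] at h1
    rw [norm_smul, hφ]
    dsimp only
    rw [inv_inv, Real.norm_eq_abs, abs_of_nonneg (by positivity)]
    refine (mul_le_mul_of_nonneg_right h1 (norm_nonneg _)).trans ?_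
    simp only [hP, Pi.smul_apply, Pi.add_apply, Finset.sum_apply, smul_eq_mul]
    rw [mul_assoc, add_mul, one_mul, Finset.sum_mul]
    refine mul_le_mul_of_nonneg_left (add_le_add_right (Finset.sum_le_sum fun i _ => ?_) _)
      (by positivity)
    rw [hH]
    dsimp only
    rw [norm_fourierInv_iterate_lineDeriv, real_inner_smul_left, abs_mul, mul_pow,
      abs_of_pos (inv_pos.2 hR0), inv_pow, mul_pow]
    have h2 : 1 ≤ (2 * Real.pi) ^ N := one_le_pow₀ (by linarith [Real.pi_gt_three])
    have h3 : 0 ≤ (R ^ N)⁻¹ * |inner ℝ x (b i)| ^ N * ‖𝓕⁻ G x‖ := by positivity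
    nlinarith
  have hsupp : Function.support G ⊆ Metric.closedBall 0 r := (subset_tsupport _).trans hG
  have hGv : eLpNorm (𝓕⁻ G : 𝓢(V, ℂ)) 2 volume ≤ vol * ENNReal.ofReal B := by
    rw [← eLpNorm_two_fourier, ← SchwartzMap.fourier_coe, FourierTransform.fourier_fourierInv_eq]
    refine eLpNorm_two_le_of_support_subset (fun x => ?_) hsupp
    simpa using hB 0 (by omega) x
  have hHv (i : Fin n) : eLpNorm (H i) 2 volume ≤ vol * ENNReal.ofReal (B * R ^ N) := by
    rw [← eLpNorm_two_fourier, ← SchwartzMap.fourier_coe, hH, FourierTransform.fourier_fourierInv_eq]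
    refine eLpNorm_two_le_of_support_subset
      (fun x => (norm_iterate_lineDeriv_le G (b.norm_eq_one i) N x).trans (hB N le_rfl x)) ?_
    rw [← iteratedLineDerivOp_const_eq_iter_lineDerivOp]
    exact (subset_tsupport _).trans ((SchwartzMap.tsupport_iteratedLineDerivOp_subset _ G).trans hG)
  have hPv : eLpNorm P 2 volume ≤
      ENNReal.ofReal ((1 + n : ℝ) ^ N) * ((vol + n * vol) * ENNReal.ofReal B) := by
    have hsm (i : Fin n) : AEStronglyMeasurable ((R ^ N)⁻¹ • fun x => ‖H i x‖) volume :=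
      ((H i).continuous.norm.aestronglyMeasurable).const_smul _
    rw [hP, eLpNorm_const_smul]
    rw [← ofReal_norm, Real.norm_eq_abs, abs_of_pos (by positivity)]
    gcongr
    refine (eLpNorm_add_le (𝓕⁻ G).continuous.norm.aestronglyMeasurable
      (Finset.aestronglyMeasurable_sum _ fun i _ => hsm i) (by norm_num)).trans ?_
    rw [add_mul]
    gcongr
    · rw [eLpNorm_norm]; exact hGv
    · refine (eLpNorm_sum_le (fun i _ => hsm i) (by norm_num)).trans ?_
      refine (Finset.sum_le_card_nsmul _ _ (vol * ENNReal.ofReal B) fun i _ => ?_).trans (by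
        simp [mul_assoc])
      rw [eLpNorm_const_smul, eLpNorm_norm, ← ofReal_norm, Real.norm_eq_abs,
        abs_of_pos (by positivity)]
      calc _ ≤ ENNReal.ofReal (R ^ N)⁻¹ * (vol * ENNReal.ofReal (B * R ^ N)) := by gcongr; exact hHv i
        _ = _ := by
          rw [mul_left_comm, ← ENNReal.ofReal_mul (by positivity)]
          congr 2; field_simp
  have hFv : eLpNorm (fun x => ((φ (R⁻¹ • x))⁻¹ : ℝ) • 𝓕⁻ G x) 2 volume ≤ eLpNorm P 2 volume :=
    eLpNorm_mono_real hpt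
  have hfac : ((𝓕⁻ G : 𝓢(V, ℂ)) : V → ℂ) = (fun x => φ (R⁻¹ • x)) • fun x => ((φ (R⁻¹ • x))⁻¹ : ℝ) • 𝓕⁻ G x := by
    ext x
    have : φ (R⁻¹ • x) ≠ 0 := by rw [hφ]; positivity
    simp [this]
  have hφR : AEStronglyMeasurable (fun x => φ (R⁻¹ • x)) volume :=
    (hφm.comp (measurable_const_smul R⁻¹)).aestronglyMeasurable
  have hFm : AEStronglyMeasurable (fun x => ((φ (R⁻¹ • x))⁻¹ : ℝ) • 𝓕⁻ G x) volume :=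
    ((hφm.comp (measurable_const_smul R⁻¹)).inv.aestronglyMeasurable).smul
      (𝓕⁻ G).continuous.aestronglyMeasurable
  calc eLpNorm (𝓕⁻ G : 𝓢(V, ℂ)) 1 volume
      ≤ eLpNorm (fun x => φ (R⁻¹ • x)) 2 volume *
          eLpNorm (fun x => ((φ (R⁻¹ • x))⁻¹ : ℝ) • 𝓕⁻ G x) 2 volume := by
        conv_lhs => rw [hfac]
        exact eLpNorm_smul_le_mul_eLpNorm hFm hφR
    _ ≤ (ENNReal.ofReal (R ^ ((n : ℝ) / 2)) * eLpNorm φ 2 volume) *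
          (ENNReal.ofReal ((1 + n : ℝ) ^ N) * ((vol + n * vol) * ENNReal.ofReal B)) := by
        rw [eLpNorm_two_comp_smul hφm hR0]
        gcongr
        exact hFv.trans hPv
    _ = _ := by
        rw [ENNReal.ofReal_mul hB0]; ring

end KernelBound

section PhaseDerivatives

variable {V : Type*} [NormedAddCommGroup V] [InnerProductSpace ℝ V]

/-- Derivatives of a smooth function that is homogeneous of degree `α` at infinity. -/
lemma exists_norm_iteratedFDeriv_le_of_homogeneous [FiniteDimensional ℝ V] {g : V → ℝ}
    (hg : ContDiff ℝ (⊤ : ℕ∞) g) {α : ℝ}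
    (hom : ∀ c : ℝ, 1 ≤ c → ∀ x, 1 / 2 < ‖x‖ → g (c • x) = c ^ α * g x) (j : ℕ) :
    ∃ C : ℝ, 0 ≤ C ∧ ∀ x, 1 ≤ ‖x‖ → ‖iteratedFDeriv ℝ j g x‖ ≤ C * ‖x‖ ^ (α - j) := by
  have hcont : Continuous (iteratedFDeriv ℝ j g) :=
    hg.continuous_iteratedFDeriv (by exact_mod_cast le_top)
  obtain ⟨C, hC⟩ := (isCompact_sphere (0 : V) 1).exists_bound_of_continuousOn hcont.continuousOn
  refine ⟨max C 0, le_max_right _ _, fun x hx => ?_⟩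
  have hx0 : 0 < ‖x‖ := by linarith
  set c := ‖x‖
  set u := c⁻¹ • x
  have hu : ‖u‖ = 1 := by simp [u, norm_smul, c, hx0.ne']
  have hxu : x = c • u := by simp [u, smul_smul, hx0.ne']
  have hev : (fun y => g (c • y)) =ᶠ[nhds u] fun y => c ^ α • g y := by
    have : ∀ᶠ y in nhds u, 1 / 2 < ‖y‖ :=
      continuous_norm.continuousAt.eventually_const_lt (by change 1 / 2 < ‖u‖; rw [hu]; norm_num)
    filter_upwards [this] with y hy
    exact hom c hx y hy
  have h1 := hev.iteratedFDeriv ℝ j |>.eq_of_nhds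
  rw [iteratedFDeriv_comp_const_smul _ (hg.of_le (by exact_mod_cast le_top))] at h1
  dsimp only at h1
  rw [← hxu,
    iteratedFDeriv_const_smul_apply' (hg.contDiffAt.of_le (by exact_mod_cast le_top))] at h1
  have h2 : iteratedFDeriv ℝ j g x = c ^ (α - j) • iteratedFDeriv ℝ j g u := by
    rw [Real.rpow_sub hx0, Real.rpow_natCast, div_eq_inv_mul, mul_smul, ← h1, smul_smul,
      inv_mul_cancel₀ (by positivity), one_smul]
  rw [h2, norm_smul, Real.norm_eq_abs, abs_of_pos (by positivity), mul_comm]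
  gcongr
  exact (hC u (by simp [hu])).trans (le_max_left _ _)

/-- The second order Taylor remainder of `g` at `a`. -/
noncomputable def taylorRemainder (g : V → ℝ) (a η : V) : ℝ := g (a + η) - g a - fderiv ℝ g a η

lemma contDiff_taylorRemainder {g : V → ℝ} (hg : ContDiff ℝ (⊤ : ℕ∞) g) (a : V) :
    ContDiff ℝ (⊤ : ℕ∞) (taylorRemainder g a) := by
  unfold taylorRemainder
  fun_prop

lemma fderiv_taylorRemainder {g : V → ℝ} (hg : ContDiff ℝ (⊤ : ℕ∞) g) (a : V) :
    fderiv ℝ (taylorRemainder g a) = fun η => fderiv ℝ g (a + η) - fderiv ℝ g a := by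
  ext1 η
  have hd : Differentiable ℝ g := hg.differentiable (by simp)
  unfold taylorRemainder
  rw [fderiv_fun_sub (by fun_prop) (by fun_prop), fderiv_sub_const, fderiv_comp_add_left,
    ContinuousLinearMap.fderiv]

lemma exists_norm_iteratedFDeriv_taylorRemainder_le [FiniteDimensional ℝ V] {g : V → ℝ}
    (hg : ContDiff ℝ (⊤ : ℕ∞) g) {α : ℝ} (hα : 2 < α)
    (hom : ∀ c : ℝ, 1 ≤ c → ∀ x, 1 / 2 < ‖x‖ → g (c • x) = c ^ α * g x) {r : ℝ} (hr : 0 ≤ r) (j : ℕ) :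
    ∃ C : ℝ, 0 ≤ C ∧ ∀ a η, r + 1 ≤ ‖a‖ → ‖η‖ ≤ r →
      ‖iteratedFDeriv ℝ (j + 1) (taylorRemainder g a) η‖ ≤ C * ‖a‖ ^ (α - 2) := by
  have hfd : ContDiff ℝ (⊤ : ℕ∞) (fderiv ℝ g) := hg.fderiv_right (by simp)
  have hnorm {a η : V} (ha : r + 1 ≤ ‖a‖) (hη : ‖η‖ ≤ r) : 1 ≤ ‖a + η‖ ∧ ‖a + η‖ ≤ 2 * ‖a‖ := by
    constructor
    · have := norm_sub_le (a + η) η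
      rw [add_sub_cancel_right] at this
      linarith
    · linarith [norm_add_le a η]
  rcases j with _ | j
  · obtain ⟨C, hC0, hC⟩ := exists_norm_iteratedFDeriv_le_of_homogeneous hg hom 2
    refine ⟨C * 2 ^ (α - 2) * r, by positivity, fun a η ha hη => ?_⟩
    rw [← norm_iteratedFDeriv_fderiv, norm_iteratedFDeriv_zero, fderiv_taylorRemainder hg]
    have hmv := (convex_closedBall a r).norm_image_sub_le_of_norm_fderiv_le (𝕜 := ℝ)
      (f := fderiv ℝ g) (C := C * (2 * ‖a‖) ^ (α - 2)) (x := a) (y := a + η)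
      (fun x _ => (hfd.differentiable (by simp)) x) (fun x hx => ?_)
      (Metric.mem_closedBall_self hr) (by simpa using hη)
    · refine hmv.trans ?_
      rw [add_sub_cancel_left, Real.mul_rpow (by norm_num) (norm_nonneg _)]
      calc _ ≤ C * (2 ^ (α - 2) * ‖a‖ ^ (α - 2)) * r := by gcongr
        _ = _ := by ring
    · have hx' : ‖x - a‖ ≤ r := by rwa [mem_closedBall_iff_norm] at hx
      have := hnorm ha hx'
      rw [add_sub_cancel] at this
      rw [← norm_iteratedFDeriv_zero (𝕜 := ℝ) (f := fderiv ℝ (fderiv ℝ g)), norm_iteratedFDeriv_fderiv,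
        norm_iteratedFDeriv_fderiv]
      refine (hC x this.1).trans ?_
      push_cast
      gcongr
      exact this.2
  · obtain ⟨C, hC0, hC⟩ := exists_norm_iteratedFDeriv_le_of_homogeneous hg hom (j + 2)
    refine ⟨C * 2 ^ (α - 2), by positivity, fun a η ha hη => ?_⟩
    have hη' := hnorm ha hη
    have e : fderiv ℝ (fderiv ℝ (taylorRemainder g a)) = fun η => fderiv ℝ (fderiv ℝ g) (a + η) := by
      rw [fderiv_taylorRemainder hg]
      ext1 η
      rw [fderiv_sub_const, fderiv_comp_add_left]
    rw [← norm_iteratedFDeriv_fderiv, ← norm_iteratedFDeriv_fderiv, e, iteratedFDeriv_comp_add_left,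
      norm_iteratedFDeriv_fderiv, norm_iteratedFDeriv_fderiv]
    refine (hC _ hη'.1).trans ?_
    rw [mul_assoc, ← Real.mul_rpow (by norm_num) (norm_nonneg _)]
    gcongr
    calc ‖a + η‖ ^ (α - ((j + 2 : ℕ) : ℝ)) ≤ ‖a + η‖ ^ (α - 2) :=
          Real.rpow_le_rpow_of_exponent_le hη'.1 (by push_cast; linarith [(Nat.cast_nonneg j : (0:ℝ) ≤ j)])
      _ ≤ _ := by
          refine Real.rpow_le_rpow (norm_nonneg _) hη'.2 (by linarith)

lemma norm_iteratedFDeriv_exp_I_le (j : ℕ) (t : ℝ) :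
    ‖iteratedFDeriv ℝ j (fun s : ℝ => Complex.exp (Complex.I * s)) t‖ ≤ 1 := by
  have h (j : ℕ) : iteratedDeriv j (fun s : ℝ => Complex.exp (Complex.I * s)) =
      fun s : ℝ => Complex.I ^ j * Complex.exp (Complex.I * s) := by
    induction j with
    | zero => simp
    | succ j ih =>
      rw [iteratedDeriv_succ, ih]
      ext1 s
      have h1 : HasDerivAt (fun s : ℝ => Complex.I * (s : ℂ)) Complex.I s := by
        simpa using (Complex.ofRealCLM.hasDerivAt (x := s)).const_mul Complex.I
      rw [(h1.cexp.const_mul _).deriv]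
      ring
  rw [norm_iteratedFDeriv_eq_norm_iteratedDeriv, h]
  simp [Complex.norm_exp]

lemma norm_iteratedFDeriv_mul_exp_le {h : V → ℝ} (hh : ContDiff ℝ (⊤ : ℕ∞) h) {χ : V → ℂ}
    (hχ : ContDiff ℝ (⊤ : ℕ∞) χ) {N : ℕ} {M R : ℝ} (hR : 1 ≤ R)
    (hM : ∀ j ≤ N, ∀ x, ‖iteratedFDeriv ℝ j χ x‖ ≤ M)
    (hD : ∀ x ∈ tsupport χ, ∀ j, 1 ≤ j → j ≤ N → ‖iteratedFDeriv ℝ j h x‖ ≤ R) {j : ℕ} (hj : j ≤ N)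
    (x : V) :
    ‖iteratedFDeriv ℝ j (fun y => χ y * Complex.exp (Complex.I * h y)) x‖ ≤
      2 ^ N * N.factorial * M * R ^ j := by
  have hE : ContDiff ℝ (⊤ : ℕ∞) (fun s : ℝ => Complex.exp (Complex.I * s)) := by
    have : ContDiff ℝ (⊤ : ℕ∞) (fun s : ℝ => (s : ℂ)) := Complex.ofRealCLM.contDiff
    fun_prop
  have hle (k : ℕ) : (k : WithTop ℕ∞) ≤ ((⊤ : ℕ∞) : WithTop ℕ∞) := by exact_mod_cast le_top
  have hM0 : 0 ≤ M := (norm_nonneg _).trans (hM 0 (Nat.zero_le _) x)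
  have hEh : ContDiff ℝ (⊤ : ℕ∞) (fun y => Complex.exp (Complex.I * h y)) := hE.comp hh
  refine (norm_iteratedFDeriv_mul_le hχ hEh x (by exact_mod_cast le_top)).trans ?_
  by_cases hx : x ∈ tsupport χ
  · have hterm (i : ℕ) (hi : i ∈ Finset.range (j + 1)) :
        (j.choose i : ℝ) * ‖iteratedFDeriv ℝ i χ x‖ *
          ‖iteratedFDeriv ℝ (j - i) (fun y => Complex.exp (Complex.I * h y)) x‖ ≤
        (j.choose i : ℝ) * (N.factorial * M * R ^ j) := by
      have hi' : i ≤ j := by simpa [Nat.lt_succ_iff] using hi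
      have h1 := norm_iteratedFDeriv_comp_le hE hh (n := j - i) (hle (j - i)) x (C := 1)
        (D := R) (fun i _ => norm_iteratedFDeriv_exp_I_le i _) (fun i hi1 hi2 =>
          (hD x hx i hi1 (by omega)).trans (le_self_pow₀ hR (by omega)))
      have h2 : ‖iteratedFDeriv ℝ (j - i) (fun y => Complex.exp (Complex.I * h y)) x‖ ≤
          N.factorial * R ^ j := by
        refine h1.trans ?_
        rw [mul_one]
        have h3 : ((j - i).factorial : ℝ) ≤ N.factorial := by
          exact_mod_cast Nat.factorial_le (by omega)
        have h4 : R ^ (j - i) ≤ R ^ j := pow_le_pow_right₀ hR (by omega)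
        gcongr
      rw [mul_assoc]
      refine mul_le_mul_of_nonneg_left ?_ (Nat.cast_nonneg _)
      calc _ ≤ M * (N.factorial * R ^ j) :=
            mul_le_mul (hM i (by omega) x) h2 (norm_nonneg _) hM0
        _ = _ := by ring
    refine (Finset.sum_le_sum hterm).trans ?_
    rw [← Finset.sum_mul, ← Nat.cast_sum, Nat.sum_range_choose]
    push_cast
    have : (2 : ℝ) ^ j ≤ 2 ^ N := pow_le_pow_right₀ (by norm_num) hj
    calc _ ≤ (2 : ℝ) ^ N * (N.factorial * M * R ^ j) := by gcongr
      _ = _ := by ring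
  · rw [Finset.sum_eq_zero]
    · positivity
    · intro i _
      have : iteratedFDeriv ℝ i χ x = 0 := by
        by_contra hne
        exact hx (support_iteratedFDeriv_subset i hne)
      simp [this]

end PhaseDerivatives

section BlockKernel

variable {V : Type*} [NormedAddCommGroup V] [InnerProductSpace ℝ V] [FiniteDimensional ℝ V]
  [MeasurableSpace V] [BorelSpace V]

lemma exists_norm_iteratedFDeriv_le_of_hasCompactSupport {V : Type*} [NormedAddCommGroup V]
    [NormedSpace ℝ V] {χ : V → ℂ} (hχ : ContDiff ℝ (⊤ : ℕ∞) χ) (hc : HasCompactSupport χ) (N : ℕ) :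
    ∃ M : ℝ, 0 ≤ M ∧ ∀ j ≤ N, ∀ x, ‖iteratedFDeriv ℝ j χ x‖ ≤ M := by
  have h (j : ℕ) : ∃ M : ℝ, ∀ x, ‖iteratedFDeriv ℝ j χ x‖ ≤ M :=
    (hχ.continuous_iteratedFDeriv (m := j) (by exact_mod_cast le_top)).bounded_above_of_compact_support
      (hc.iteratedFDeriv j)
  choose M hM using h
  have h0 (j : ℕ) : 0 ≤ M j := (norm_nonneg _).trans (hM j 0)
  exact ⟨∑ j ∈ Finset.range (N + 1), M j, Finset.sum_nonneg fun j _ => h0 j, fun j hj x =>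
    (hM j x).trans (Finset.single_le_sum (f := M) (fun j _ => h0 j)
      (Finset.mem_range.2 (Nat.lt_succ_of_le hj)))⟩

lemma IsWiener.exp_clm_mul {m : V → ℂ} {A : ℝ≥0∞} (h : IsWiener m A) (L : V →L[ℝ] ℝ) :
    IsWiener (fun ξ => Complex.exp (Complex.I * (L ξ : ℝ)) * m ξ) A := by
  set b : V := (2 * Real.pi)⁻¹ • (InnerProductSpace.toDual ℝ V).symm L with hb
  convert! h.fourierChar_mul b using 1
  ext ξ
  congr 1
  rw [Real.fourierChar_apply, hb, real_inner_smul_left, InnerProductSpace.toDual_symm_apply]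
  congr 1
  have : (Real.pi : ℂ) ≠ 0 := by exact_mod_cast Real.pi_ne_zero
  push_cast
  field_simp

/-- Kernel bound for a unit frequency block of `e^{ig}` with `g` homogeneous of degree `α` at
infinity. -/
lemma exists_isWiener_block {g : V → ℝ} (hg : ContDiff ℝ (⊤ : ℕ∞) g) {α : ℝ} (hα : 2 < α)
    (hom : ∀ c : ℝ, 1 ≤ c → ∀ x, 1 / 2 < ‖x‖ → g (c • x) = c ^ α * g x)
    {χ : V → ℂ} (hχ : ContDiff ℝ (⊤ : ℕ∞) χ) {r : ℝ} (hr : 0 ≤ r)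
    (hχr : tsupport χ ⊆ Metric.closedBall 0 r) :
    ∃ C : ℝ≥0∞, C ≠ ∞ ∧ ∀ a : V, r + 1 ≤ ‖a‖ →
      IsWiener (fun η => χ (η - a) * Complex.exp (Complex.I * (g η : ℝ)))
        (C * ENNReal.ofReal (‖a‖ ^ ((α - 2) * Module.finrank ℝ V / 2))) := by
  set n := Module.finrank ℝ V
  have hc : HasCompactSupport χ := (isCompact_closedBall (0 : V) r).of_isClosed_subset
    (isClosed_tsupport χ) hχr
  obtain ⟨M, hM0, hM⟩ := exists_norm_iteratedFDeriv_le_of_hasCompactSupport hχ hc (n + 1)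
  choose D hD0 hD using exists_norm_iteratedFDeriv_taylorRemainder_le hg hα hom hr
  obtain ⟨C, hC, hCG⟩ := exists_eLpNorm_fourierInv_le V r
  set D' := 1 + ∑ j ∈ Finset.range (n + 1), D j with hD'
  have hD'1 : 1 ≤ D' := by
    have : 0 ≤ ∑ j ∈ Finset.range (n + 1), D j := Finset.sum_nonneg fun j _ => hD0 j
    linarith
  set B : ℝ := 2 ^ (n + 1) * (n + 1).factorial * M
  have hB0 : 0 ≤ B := by positivity
  refine ⟨C * ENNReal.ofReal (B * D' ^ ((n : ℝ) / 2)), by finiteness, fun a ha => ?_⟩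
  have ha1 : 1 ≤ ‖a‖ := by linarith
  have ha0 : 0 < ‖a‖ := by linarith
  set R := D' * ‖a‖ ^ (α - 2) with hR
  have haR : 1 ≤ ‖a‖ ^ (α - 2) := Real.one_le_rpow ha1 (by linarith)
  have hR1 : 1 ≤ R := one_le_mul_of_one_le_of_one_le hD'1 haR
  set h := taylorRemainder g a
  have hh : ContDiff ℝ (⊤ : ℕ∞) h := contDiff_taylorRemainder hg a
  have hhI : ContDiff ℝ (⊤ : ℕ∞) (fun y => (h y : ℂ)) := Complex.ofRealCLM.contDiff.comp hh
  set G : V → ℂ := fun y => χ y * Complex.exp (Complex.I * h y) with hG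
  have hGs : ContDiff ℝ (⊤ : ℕ∞) G := by fun_prop
  have hGc : HasCompactSupport G := hc.mul_right
  set GS : 𝓢(V, ℂ) := hGc.toSchwartzMap hGs
  have hderiv : ∀ j ≤ n + 1, ∀ x, ‖iteratedFDeriv ℝ j GS x‖ ≤ B * R ^ j := by
    intro j hj x
    refine norm_iteratedFDeriv_mul_exp_le hh hχ hR1 hM (fun x hx j h1 h2 => ?_) hj x
    obtain ⟨j, rfl⟩ := Nat.exists_eq_add_of_le' h1
    refine (hD j a x ha (by simpa using hχr hx)).trans ?_
    rw [hR]
    gcongr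
    have := Finset.single_le_sum (f := D) (s := Finset.range (n + 1)) (fun j _ => hD0 j)
      (Finset.mem_range.2 (show j < n + 1 by omega))
    linarith
  have hts : tsupport GS ⊆ Metric.closedBall 0 r :=
    (closure_mono (Function.support_mul_subset_left _ _)).trans hχr
  have hW := (isWiener_schwartz GS).mono (hCG GS B R hR1 hts hderiv)
  have hW2 := ((hW.comp_sub a).exp_clm_mul (fderiv ℝ g a)).const_mul
    (Complex.exp (Complex.I * ((g a - fderiv ℝ g a a : ℝ) : ℂ)))
  have hnorm : ‖Complex.exp (Complex.I * ((g a - fderiv ℝ g a a : ℝ) : ℂ))‖ₑ = 1 := by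
    rw [← ofReal_norm, mul_comm, Complex.norm_exp_ofReal_mul_I, ENNReal.ofReal_one]
  rw [hnorm, one_mul] at hW2
  have hconst : C * ENNReal.ofReal (B * R ^ ((n : ℝ) / 2)) =
      C * ENNReal.ofReal (B * D' ^ ((n : ℝ) / 2)) * ENNReal.ofReal (‖a‖ ^ ((α - 2) * n / 2)) := by
    clear_value B
    rw [hR, Real.mul_rpow (by positivity) (by positivity), ← Real.rpow_mul ha0.le, mul_div_assoc,
      ← mul_assoc B, ENNReal.ofReal_mul (by positivity), mul_assoc C]
  rw [hconst] at hW2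
  convert! hW2 using 1
  ext η
  change _ = _ * (_ * (χ (η - a) * Complex.exp (Complex.I * ((taylorRemainder g a (η - a) : ℝ) : ℂ))))
  rw [mul_left_comm (Complex.exp (Complex.I * ((fderiv ℝ g a η : ℝ) : ℂ))), mul_left_comm,
    ← Complex.exp_add, ← Complex.exp_add]
  congr 2
  rw [taylorRemainder, add_sub_cancel, map_sub]
  push_cast
  ring

/-- Kernel bound for the unit frequency blocks of `e^{i|D|^α}`, `α > 2`. -/
theorem exists_isWiener_block_norm_rpow {α : ℝ} (hα : 2 < α) (χ : ContDiffBump (0 : V)) :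
    ∃ C : ℝ≥0∞, C ≠ ∞ ∧ ∀ a : V,
      IsWiener (fun η => (χ (η - a) : ℂ) *
          Complex.exp (Complex.I * ((‖(2 * Real.pi) • η‖ ^ α : ℝ) : ℂ)))
        (C * ENNReal.ofReal (Real.sqrt (1 + ‖(2 * Real.pi) • a‖ ^ 2) ^
          ((α - 2) * Module.finrank ℝ V / 2))) := by
  set n := Module.finrank ℝ V
  have hχ : ContDiff ℝ (⊤ : ℕ∞) (fun η => (χ η : ℂ)) := Complex.ofRealCLM.contDiff.comp χ.contDiff
  have hχt : tsupport (fun η => (χ η : ℂ)) ⊆ Metric.closedBall 0 χ.rOut := by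
    rw [← χ.tsupport_eq]
    refine closure_mono fun x hx => ?_
    simpa using hx
  have hχc : HasCompactSupport (fun η => (χ η : ℂ)) := χ.hasCompactSupport.comp_left
    (g := fun t : ℝ => (t : ℂ)) (by simp)
  have hr0 := χ.rOut_pos
  have hnormpi (η : V) : ‖(2 * Real.pi) • η‖ ^ α = (2 * Real.pi) ^ α * ‖η‖ ^ α := by
    rw [norm_smul, Real.norm_eq_abs, abs_of_pos (by positivity),
      Real.mul_rpow (by positivity) (norm_nonneg _)]
  have hexp : 0 ≤ (α - 2) * n / 2 := by
    have : 0 < α - 2 := by linarith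
    positivity
  -- frequencies away from the origin
  let θ : ContDiffBump (0 : V) := ⟨1 / 4, 1 / 2, by norm_num, by norm_num⟩
  set g : V → ℝ := fun η => ‖η‖ ^ α * ((2 * Real.pi) ^ α * (1 - θ η)) with hg
  have hgeq (η : V) (hη : 1 / 2 ≤ ‖η‖) : g η = ‖(2 * Real.pi) • η‖ ^ α := by
    rw [hg, hnormpi]
    dsimp only
    rw [θ.zero_of_le_dist (by simpa [θ] using hη)]
    ring
  have hgs : ContDiff ℝ (⊤ : ℕ∞) g := by
    refine contDiff_norm_rpow_mul_of_eq_zero (r := 1 / 4) (by norm_num)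
      (contDiff_const.mul (contDiff_const.sub θ.contDiff)) fun ξ hξ => ?_
    rw [θ.one_of_mem_closedBall (by simpa [θ] using hξ.le)]
    ring
  have hom : ∀ c : ℝ, 1 ≤ c → ∀ x, 1 / 2 < ‖x‖ → g (c • x) = c ^ α * g x := by
    intro c hc x hx
    have hc0 : 0 < c := by linarith
    rw [hgeq _ hx.le, hgeq, smul_comm, norm_smul, Real.norm_eq_abs, abs_of_pos hc0,
      Real.mul_rpow hc0.le (norm_nonneg _)]
    rw [norm_smul, Real.norm_eq_abs, abs_of_pos hc0]
    nlinarith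
  obtain ⟨C₁, hC₁, hW₁⟩ := exists_isWiener_block hgs hα hom hχ hr0.le hχt
  -- frequencies near the origin
  let Θ : ContDiffBump (0 : V) := ⟨2 * χ.rOut + 1, 2 * χ.rOut + 2, by linarith, by linarith⟩
  let Ψ : ContDiffBump (0 : V) := ⟨2 * χ.rOut + 2, 2 * χ.rOut + 3, by linarith, by linarith⟩
  obtain ⟨D, hD, hDW⟩ := isWiener_norm_rpow_mul (by linarith : 0 < α) Ψ
  have hΘs : ContDiff ℝ (⊤ : ℕ∞) (fun η => (Θ η : ℂ)) := Complex.ofRealCLM.contDiff.comp Θ.contDiff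
  have hΘc : HasCompactSupport (fun η => (Θ η : ℂ)) := Θ.hasCompactSupport.comp_left
    (g := fun t : ℝ => (t : ℂ)) (by simp)
  obtain ⟨E, hE, hEW⟩ := (isWiener_schwartz (hΘc.toSchwartzMap hΘs)).mul_exp
    (hDW.const_mul (((2 * Real.pi) ^ α : ℝ) : ℂ)) (SchwartzMap.eLpNorm_lt_top _ 1 volume).ne
    (ENNReal.mul_ne_top (by simp) hD)
  have hχW := isWiener_schwartz (hχc.toSchwartzMap hχ)
  set F := eLpNorm (𝓕⁻ (hχc.toSchwartzMap hχ) : 𝓢(V, ℂ)) 1 volume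
  have hF : F ≠ ∞ := (SchwartzMap.eLpNorm_lt_top _ 1 volume).ne
  refine ⟨C₁ + F * E, by finiteness, fun a => ?_⟩
  have hbr : 1 ≤ Real.sqrt (1 + ‖(2 * Real.pi) • a‖ ^ 2) := by
    rw [Real.one_le_sqrt]; nlinarith [sq_nonneg ‖(2 * Real.pi) • a‖]
  by_cases ha : χ.rOut + 1 ≤ ‖a‖
  · have h := hW₁ a ha
    have hle : ‖a‖ ≤ Real.sqrt (1 + ‖(2 * Real.pi) • a‖ ^ 2) := by
      refine Real.le_sqrt_of_sq_le ?_
      rw [norm_smul, Real.norm_eq_abs, abs_of_pos (by positivity), mul_pow]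
      have : 1 ≤ (2 * Real.pi) ^ 2 := one_le_pow₀ (by linarith [Real.pi_gt_three])
      nlinarith [sq_nonneg ‖a‖]
    convert! h.mono (B := (C₁ + F * E) * ENNReal.ofReal (Real.sqrt (1 + ‖(2 * Real.pi) • a‖ ^ 2) ^
      ((α - 2) * n / 2))) ?_ using 1
    · ext η
      by_cases hη : ‖η - a‖ < χ.rOut
      · rw [hgeq]
        have := norm_sub_le a (a - η)
        rw [sub_sub_cancel, norm_sub_rev a η] at this
        have h3 : ‖a‖ ≤ ‖η‖ + ‖η - a‖ := by
          have := norm_sub_le η (η - a)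
          rwa [sub_sub_cancel] at this
        linarith
      · rw [χ.zero_of_le_dist (by simpa using hη)]; simp
    · gcongr
      exact le_self_add
  · push Not at ha
    have h := (hχW.comp_sub a).mul hEW
    convert! h.mono (B := (C₁ + F * E) * ENNReal.ofReal (Real.sqrt (1 + ‖(2 * Real.pi) • a‖ ^ 2) ^
      ((α - 2) * n / 2))) ?_ using 1
    · ext η
      change _ = (χ (η - a) : ℂ) * ((Θ η : ℂ) * _)
      by_cases hη : ‖η - a‖ < χ.rOut
      · have h3 : ‖η‖ ≤ 2 * χ.rOut + 1 := by
          have := norm_add_le (η - a) a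
          rw [sub_add_cancel] at this
          linarith
        rw [Θ.one_of_mem_closedBall (by simpa [Θ] using h3),
          Ψ.one_of_mem_closedBall (by simp [Ψ]; linarith), hnormpi]
        push_cast
        ring_nf
      · rw [χ.zero_of_le_dist (by simpa using hη)]; simp
    · calc F * E ≤ (C₁ + F * E) * 1 := by rw [mul_one]; exact le_add_self
        _ ≤ _ := by
          gcongr
          rw [ENNReal.one_le_ofReal]
          exact Real.one_le_rpow hbr hexp

end BlockKernel

section FourierFlip

variable {V : Type*} [NormedAddCommGroup V] [InnerProductSpace ℝ V] [FiniteDimensional ℝ V]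
  [MeasurableSpace V] [BorelSpace V]

/-- The inverse Fourier transform is symmetric for the pairing `∫ f g` of integrable functions. -/
lemma integral_fourierInv_mul_eq {f g : V → ℂ} (hf : Integrable f) (hg : Integrable g) :
    ∫ x, 𝓕⁻ f x * g x = ∫ x, f x * 𝓕⁻ g x := by
  have h := VectorFourier.integral_fourierIntegral_smul_eq_flip (L := -innerₗ V)
    (μ := (volume : Measure V)) (ν := (volume : Measure V)) Real.continuous_fourierChar
    (continuous_inner (𝕜 := ℝ) (E := V)).neg hf hg
  have hfl : (-innerₗ V : V →ₗ[ℝ] V →ₗ[ℝ] ℝ).flip = -innerₗ V := by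
    ext x y
    simp [real_inner_comm]
  rw [hfl] at h
  have hinv (u : V → ℂ) (x : V) :
      VectorFourier.fourierIntegral Real.fourierChar volume (-innerₗ V) u x = 𝓕⁻ u x := by
    rw [Real.fourierInv_eq, VectorFourier.fourierIntegral]
    simp
  simpa [hinv] using! h

end FourierFlip

section LpENorm

variable {n : ℕ} {p : ℝ≥0∞} [Fact (1 ≤ p)]

lemma lpENorm_le_eLpNorm {v : 𝓢'(EuclideanSpace ℝ (Fin n), ℂ)}
    {h : EuclideanSpace ℝ (Fin n) → ℂ} (hh : MemLp h p volume)
    (hv : ∀ ψ : 𝓢(EuclideanSpace ℝ (Fin n), ℂ), v ψ = ∫ x, ψ x • h x) :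
    lpENorm p v ≤ eLpNorm h p volume := by
  have hT : Lp.toTemperedDistribution (hh.toLp h) = v := by
    ext ψ
    rw [Lp.toTemperedDistribution_apply, hv]
    refine integral_congr_ae ?_
    filter_upwards [hh.coeFn_toLp] with x hx
    rw [hx]
  refine (iInf₂_le (hh.toLp h) hT).trans (le_of_eq ?_)
  rw [Lp.enorm_toLp]

lemma eLpNorm_le_lpENorm_coe (f : 𝓢(EuclideanSpace ℝ (Fin n), ℂ)) :
    eLpNorm f p volume ≤ lpENorm p (f : 𝓢'(EuclideanSpace ℝ (Fin n), ℂ)) := by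
  refine le_iInf₂ fun g hg => le_of_eq ?_
  have hinj : Function.Injective
      (Lp.toTemperedDistributionCLM ℂ (volume : Measure (EuclideanSpace ℝ (Fin n))) p) :=
    LinearMap.ker_eq_bot.mp Lp.ker_toTemperedDistributionCLM_eq_bot
  have hgf : g = f.toLp p volume := hinj (by
    rw [Lp.toTemperedDistributionCLM_apply, Lp.toTemperedDistributionCLM_apply, hg,
      Lp.toTemperedDistribution_toLp_eq])
  rw [hgf, Lp.enorm_def]
  exact eLpNorm_congr_ae (f.coeFn_toLp p volume).symm

lemma lpENorm_coe (f : 𝓢(EuclideanSpace ℝ (Fin n), ℂ)) :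
    lpENorm p (f : 𝓢'(EuclideanSpace ℝ (Fin n), ℂ)) = eLpNorm f p volume :=
  le_antisymm (lpENorm_le_eLpNorm (f.memLp p volume) fun ψ => SchwartzMap.coe_apply f ψ)
    (eLpNorm_le_lpENorm_coe f)

end LpENorm

section Box

variable {n : ℕ}

/-- The multiplier of `φ(D - k)` in the normalization of Mathlib's Fourier transform. -/
noncomputable def boxSymbol (φ : 𝓢(EuclideanSpace ℝ (Fin n), ℂ)) (k : Fin n → ℤ)
    (η : EuclideanSpace ℝ (Fin n)) : ℂ :=
  φ ((2 * Real.pi) • η - latticePoint k)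

lemma boxSymbol_hasTemperateGrowth (φ : 𝓢(EuclideanSpace ℝ (Fin n), ℂ)) (k : Fin n → ℤ) :
    (boxSymbol φ k).HasTemperateGrowth :=
  φ.hasTemperateGrowth.comp (by fun_prop)

/-- `φ(D - k) f` as a Schwartz function. -/
noncomputable def boxSchwartz (φ : 𝓢(EuclideanSpace ℝ (Fin n), ℂ)) (k : Fin n → ℤ)
    (f : 𝓢(EuclideanSpace ℝ (Fin n), ℂ)) : 𝓢(EuclideanSpace ℝ (Fin n), ℂ) :=
  SchwartzMap.fourierMultiplierCLM ℂ (boxSymbol φ k) f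

lemma boxOperator_coe (φ : 𝓢(EuclideanSpace ℝ (Fin n), ℂ)) (k : Fin n → ℤ)
    (f : 𝓢(EuclideanSpace ℝ (Fin n), ℂ)) :
    boxOperator φ k (f : 𝓢'(EuclideanSpace ℝ (Fin n), ℂ)) = boxSchwartz φ k f :=
  TemperedDistribution.fourierMultiplierCLM_toTemperedDistributionCLM_eq
    (boxSymbol_hasTemperateGrowth φ k) f

lemma fourier_boxSchwartz (φ : 𝓢(EuclideanSpace ℝ (Fin n), ℂ)) (k : Fin n → ℤ)
    (f : 𝓢(EuclideanSpace ℝ (Fin n), ℂ)) (η : EuclideanSpace ℝ (Fin n)) :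
    𝓕 (boxSchwartz φ k f : EuclideanSpace ℝ (Fin n) → ℂ) η
      = boxSymbol φ k η * 𝓕 (f : EuclideanSpace ℝ (Fin n) → ℂ) η := by
  rw [← SchwartzMap.fourier_coe, boxSchwartz, SchwartzMap.fourierMultiplierCLM_apply,
    FourierTransform.fourier_fourierInv_eq,
    SchwartzMap.smulLeftCLM_apply_apply (boxSymbol_hasTemperateGrowth φ k), smul_eq_mul,
    SchwartzMap.fourier_coe]

/-- `φ(D - k)` applied to a tempered distribution that is the inverse Fourier transform of an
integrable function. -/
lemma boxOperator_apply_of_fourierInv (φ : 𝓢(EuclideanSpace ℝ (Fin n), ℂ)) (k : Fin n → ℤ)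
    {u : 𝓢'(EuclideanSpace ℝ (Fin n), ℂ)} {F : EuclideanSpace ℝ (Fin n) → ℂ} (hF : Integrable F)
    (hu : ∀ ψ : 𝓢(EuclideanSpace ℝ (Fin n), ℂ), u ψ = ∫ x, ψ x • 𝓕⁻ F x)
    (ψ : 𝓢(EuclideanSpace ℝ (Fin n), ℂ)) :
    boxOperator φ k u ψ = ∫ x, ψ x • 𝓕⁻ (fun η => boxSymbol φ k η * F η) x := by
  have hφ := boxSymbol_hasTemperateGrowth φ k
  obtain ⟨C, hC⟩ := φ.decay 0 0
  have hint : Integrable (fun η => boxSymbol φ k η * F η) := by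
    refine hF.bdd_mul (c := C) ?_ (ae_of_all _ fun η => by simpa [boxSymbol] using hC.2 _)
    exact hφ.1.continuous.aestronglyMeasurable
  change u (𝓕 (SchwartzMap.smulLeftCLM ℂ (boxSymbol φ k) (𝓕⁻ ψ))) = _
  set G := SchwartzMap.smulLeftCLM ℂ (boxSymbol φ k) (𝓕⁻ ψ) with hG
  rw [hu]
  simp only [smul_eq_mul]
  rw [← integral_fourierInv_mul_eq ψ.integrable hint]
  simp_rw [mul_comm _ (𝓕⁻ F _)]
  rw [integral_fourierInv_mul_eq hF (𝓕 G : 𝓢(EuclideanSpace ℝ (Fin n), ℂ)).integrable,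
    ← SchwartzMap.fourierInv_coe, FourierTransform.fourierInv_fourier_eq]
  refine integral_congr_ae (ae_of_all _ fun η => ?_)
  simp only [hG]
  rw [SchwartzMap.smulLeftCLM_apply_apply hφ, smul_eq_mul, SchwartzMap.fourierInv_coe]
  ring

end Box

section Decay

variable {V : Type*} [NormedAddCommGroup V] [InnerProductSpace ℝ V]

/-- The Schwartz seminorms of `Φ(· - a) G` decay rapidly in `a`. -/
lemma exists_seminorm_translate_mul_le (Φ G : 𝓢(V, ℂ)) (M l m : ℕ) :
    ∃ C : ℝ, 0 ≤ C ∧ ∀ a : V, ∀ x : V,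
      (‖x‖ ^ l * ‖iteratedFDeriv ℝ m (fun y => Φ (y - a) * G y) x‖) * (1 + ‖a‖) ^ M ≤ C := by
  set A := 2 ^ M * (Finset.Iic (M, m)).sup (fun m => SchwartzMap.seminorm ℝ m.1 m.2) Φ with hA
  set B := 2 ^ (M + l) * (Finset.Iic (M + l, m)).sup (fun m => SchwartzMap.seminorm ℝ m.1 m.2) G
    with hB
  have hA0 : 0 ≤ A := by positivity
  have hB0 : 0 ≤ B := by positivity
  refine ⟨∑ i ∈ Finset.range (m + 1), (m.choose i : ℝ) * (A * B), by positivity, fun a x => ?_⟩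
  have hprod : ‖iteratedFDeriv ℝ m (fun y => Φ (y - a) * G y) x‖ ≤
      ∑ i ∈ Finset.range (m + 1), (m.choose i : ℝ) * ‖iteratedFDeriv ℝ i Φ (x - a)‖ *
        ‖iteratedFDeriv ℝ (m - i) G x‖ := by
    have h := norm_iteratedFDeriv_mul_le (𝕜 := ℝ) (N := (⊤ : ℕ∞)) (f := fun y => Φ (y - a)) (g := G)
      (Φ.smooth _ |>.comp (contDiff_id.sub contDiff_const)) (G.smooth _) x (n := m)
      (by exact_mod_cast le_top)
    simpa only [iteratedFDeriv_comp_sub] using h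
  have ha : (1 + ‖a‖) ^ M ≤ (1 + ‖x - a‖) ^ M * (1 + ‖x‖) ^ M := by
    rw [← mul_pow]
    gcongr
    have : ‖a‖ ≤ ‖x - a‖ + ‖x‖ := by
      have := norm_sub_le x (x - a)
      rw [sub_sub_cancel] at this
      linarith
    nlinarith [norm_nonneg (x - a), norm_nonneg x]
  have hx : ‖x‖ ^ l ≤ (1 + ‖x‖) ^ l := by gcongr; linarith
  calc (‖x‖ ^ l * ‖iteratedFDeriv ℝ m (fun y => Φ (y - a) * G y) x‖) * (1 + ‖a‖) ^ M
      ≤ ((1 + ‖x‖) ^ l * ∑ i ∈ Finset.range (m + 1), (m.choose i : ℝ) *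
          ‖iteratedFDeriv ℝ i Φ (x - a)‖ * ‖iteratedFDeriv ℝ (m - i) G x‖) *
          ((1 + ‖x - a‖) ^ M * (1 + ‖x‖) ^ M) := by gcongr
    _ = ∑ i ∈ Finset.range (m + 1), (m.choose i : ℝ) *
          (((1 + ‖x - a‖) ^ M * ‖iteratedFDeriv ℝ i Φ (x - a)‖) *
          ((1 + ‖x‖) ^ (M + l) * ‖iteratedFDeriv ℝ (m - i) G x‖)) := by
        rw [Finset.mul_sum, Finset.sum_mul]
        refine Finset.sum_congr rfl fun i _ => ?_
        rw [pow_add]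
        ring
    _ ≤ _ := by
        refine Finset.sum_le_sum fun i hi => ?_
        have hi' : i ≤ m := Nat.lt_succ_iff.mp (Finset.mem_range.mp hi)
        gcongr
        · exact one_add_le_sup_seminorm_apply (𝕜 := ℝ) (m := (M, m)) le_rfl hi' Φ (x - a)
        · exact one_add_le_sup_seminorm_apply (𝕜 := ℝ) (m := (M + l, m)) le_rfl (Nat.sub_le _ _) G x

variable [FiniteDimensional ℝ V] [MeasurableSpace V] [BorelSpace V]

lemma exists_eLpNorm_fourierInv_translate_mul_le (p : ℝ≥0∞) [Fact (1 ≤ p)] (Φ G : 𝓢(V, ℂ))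
    (M : ℕ) : ∃ C : ℝ, 0 ≤ C ∧ ∀ (a : V) (H : 𝓢(V, ℂ)), (∀ y, H y = Φ (y - a) * G y) →
      eLpNorm (𝓕⁻ H : 𝓢(V, ℂ)) p volume ≤ ENNReal.ofReal (C * ((1 + ‖a‖) ^ M)⁻¹) := by
  let T : 𝓢(V, ℂ) →L[ℂ] Lp ℂ p (volume : Measure V) :=
    (toLpCLM ℂ ℂ p (volume : Measure V)).comp (FourierTransform.fourierInvCLM ℂ 𝓢(V, ℂ))
  let Q : Seminorm ℂ 𝓢(V, ℂ) := (normSeminorm ℂ (Lp ℂ p (volume : Measure V))).comp T.toLinearMap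
  have hQ : Continuous Q := continuous_norm.comp T.continuous
  obtain ⟨S, c, -, hS⟩ := Seminorm.bound_of_continuous (schwartz_withSeminorms ℂ V ℂ) Q hQ
  choose D hD0 hD using exists_seminorm_translate_mul_le Φ G M
  refine ⟨c * ∑ i ∈ S, D i.1 i.2, mul_nonneg c.2 (Finset.sum_nonneg fun i _ => hD0 _ _),
    fun a H hH => ?_⟩
  have hHe : (H : V → ℂ) = fun y => Φ (y - a) * G y := funext hH
  have h1 : ‖T H‖ ≤ (c * ∑ i ∈ S, D i.1 i.2) * ((1 + ‖a‖) ^ M)⁻¹ := by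
    have h2 : ‖T H‖ ≤ c * (S.sup (schwartzSeminormFamily ℂ V ℂ)) H := hS H
    refine h2.trans ?_
    rw [mul_assoc]
    gcongr
    refine Seminorm.finset_sup_apply_le (by
      exact mul_nonneg (Finset.sum_nonneg fun i _ => hD0 _ _) (by positivity)) fun i hi => ?_
    have h3 : schwartzSeminormFamily ℂ V ℂ i H ≤ D i.1 i.2 * ((1 + ‖a‖) ^ M)⁻¹ := by
      refine seminorm_le_bound ℂ i.1 i.2 H (mul_nonneg (hD0 _ _) (by positivity)) fun x => ?_
      rw [hHe, ← div_eq_mul_inv, le_div_iff₀ (by positivity)]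
      exact hD i.1 i.2 a x
    refine h3.trans ?_
    gcongr
    exact Finset.single_le_sum (f := fun i => D i.1 i.2) (fun i _ => hD0 _ _) hi
  have h4 : eLpNorm (𝓕⁻ H : 𝓢(V, ℂ)) p volume = ‖T H‖ₑ := by
    change _ = ‖(𝓕⁻ H : 𝓢(V, ℂ)).toLp p volume‖ₑ
    rw [Lp.enorm_def]
    exact eLpNorm_congr_ae ((𝓕⁻ H : 𝓢(V, ℂ)).coeFn_toLp p volume).symm
  rw [h4, ← ofReal_norm]
  exact ENNReal.ofReal_le_ofReal h1

end Decay

section Lattice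

variable {n : ℕ}

lemma japaneseBracket_pos (ξ : EuclideanSpace ℝ (Fin n)) : 0 < japaneseBracket ξ :=
  Real.sqrt_pos.mpr (by positivity)

lemma one_le_japaneseBracket (ξ : EuclideanSpace ℝ (Fin n)) : 1 ≤ japaneseBracket ξ :=
  Real.one_le_sqrt.mpr (by nlinarith [sq_nonneg ‖ξ‖])

lemma norm_le_japaneseBracket (ξ : EuclideanSpace ℝ (Fin n)) : ‖ξ‖ ≤ japaneseBracket ξ :=
  Real.le_sqrt_of_sq_le (by linarith)

lemma japaneseBracket_le_one_add (ξ : EuclideanSpace ℝ (Fin n)) : japaneseBracket ξ ≤ 1 + ‖ξ‖ :=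
  Real.sqrt_le_iff.mpr ⟨by positivity, by nlinarith [norm_nonneg ξ]⟩

lemma latticePoint_injective : Function.Injective (latticePoint (n := n)) := fun k l h => by
  funext i
  have := congrArg (fun v : EuclideanSpace ℝ (Fin n) => v i) h
  simpa [latticePoint] using this

lemma summable_japaneseBracket_latticePoint {t : ℝ} (ht : t < -(n : ℝ)) :
    Summable fun k : Fin n → ℤ => japaneseBracket (latticePoint k) ^ t := by
  classical
  have hlat : ∃ (L : Submodule ℤ (EuclideanSpace ℝ (Fin n))) (_ : DiscreteTopology L)
      (_ : IsZLattice ℝ L), ∀ k : Fin n → ℤ, latticePoint k ∈ L := by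
    let b := (EuclideanSpace.basisFun (Fin n) ℝ).toBasis
    refine ⟨Submodule.span ℤ (Set.range b), inferInstance, inferInstance, fun k => ?_⟩
    refine (b.mem_span_iff_repr_mem ℤ _).mpr fun i => ⟨k i, ?_⟩
    simp [b, latticePoint]
  obtain ⟨L, _, _, hmem⟩ := hlat
  have hrank : Module.finrank ℤ L = n := by
    rw [ZLattice.rank ℝ L, finrank_euclideanSpace_fin]
  have h0 : t < 0 := ht.trans_le (by simp)
  have h1 : Summable fun k : Fin n → ℤ => ‖latticePoint k‖ ^ t := by
    have hj : Function.Injective fun k : Fin n → ℤ => (⟨latticePoint k, hmem k⟩ : L) :=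
      fun k l h => latticePoint_injective (congrArg Subtype.val h)
    have hs : Summable fun z : L => ‖(z : EuclideanSpace ℝ (Fin n))‖ ^ t :=
      ZLattice.summable_norm_rpow L t (lt_of_lt_of_eq ht (by rw [hrank]))
    have hs' := hs.comp_injective hj
    exact hs'
  have h2 : Summable fun k : Fin n → ℤ => if k = 0 then (1 : ℝ) else 0 :=
    (hasSum_single 0 fun k hk => if_neg hk).summable
  refine Summable.of_nonneg_of_le
    (fun k => Real.rpow_nonneg (japaneseBracket_pos _).le _) (fun k => ?_) (h1.add h2)
  by_cases hk : k = 0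
  · rw [if_pos hk]
    have : japaneseBracket (latticePoint k) ^ t ≤ 1 :=
      Real.rpow_le_one_of_one_le_of_nonpos (one_le_japaneseBracket _) h0.le
    have := Real.rpow_nonneg (norm_nonneg (latticePoint k)) t
    linarith
  · rw [if_neg hk, add_zero]
    have hk' : latticePoint k ≠ 0 := fun h => hk (latticePoint_injective (by
      rw [h]; ext i; simp [latticePoint]))
    exact Real.rpow_le_rpow_of_nonpos (norm_pos_iff.mpr hk') (norm_le_japaneseBracket _) h0.le

end Lattice

section Finiteness

variable {n : ℕ}

lemma exists_lpENorm_boxOperator_coe_le (p : ℝ≥0∞) [Fact (1 ≤ p)]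
    (φ f : 𝓢(EuclideanSpace ℝ (Fin n), ℂ)) (M : ℕ) :
    ∃ C : ℝ, 0 ≤ C ∧ ∀ k : Fin n → ℤ,
      lpENorm p (boxOperator φ k (f : 𝓢'(EuclideanSpace ℝ (Fin n), ℂ))) ≤
        ENNReal.ofReal (C * japaneseBracket (latticePoint k) ^ (-(M : ℝ))) := by
  have hpi : (2 * Real.pi) ≠ 0 := by positivity
  let Φ : 𝓢(EuclideanSpace ℝ (Fin n), ℂ) := SchwartzMap.compCLMOfContinuousLinearEquiv ℂ
    (ContinuousLinearEquiv.smulLeft (R₁ := ℝ) (Units.mk0 (2 * Real.pi) hpi)) φ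
  have hΦ (y) : Φ y = φ ((2 * Real.pi) • y) := rfl
  obtain ⟨C, hC0, hC⟩ := exists_eLpNorm_fourierInv_translate_mul_le p Φ
    (𝓕 f : 𝓢(EuclideanSpace ℝ (Fin n), ℂ)) M
  refine ⟨C * (2 * Real.pi) ^ M, by positivity, fun k => ?_⟩
  rw [boxOperator_coe, lpENorm_coe, boxSchwartz, SchwartzMap.fourierMultiplierCLM_apply]
  refine (hC ((2 * Real.pi)⁻¹ • latticePoint k) _ fun y => ?_).trans ?_
  · rw [SchwartzMap.smulLeftCLM_apply_apply (boxSymbol_hasTemperateGrowth φ k), smul_eq_mul, hΦ,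
      boxSymbol, smul_sub, smul_inv_smul₀ hpi]
  · refine ENNReal.ofReal_le_ofReal ?_
    rw [mul_assoc, Real.rpow_neg (japaneseBracket_pos _).le, Real.rpow_natCast,
      ← div_eq_mul_inv (_ ^ M), ← div_pow, ← inv_pow]
    gcongr
    rw [inv_le_comm₀ (by positivity) (div_pos (by positivity) (japaneseBracket_pos _)), inv_div,
      div_le_iff₀ (by positivity)]
    refine (japaneseBracket_le_one_add _).trans ?_
    rw [norm_smul, norm_inv, Real.norm_eq_abs, abs_of_pos (by positivity), add_mul, mul_right_comm,
      inv_mul_cancel₀ hpi]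
    have : (3 : ℝ) < Real.pi := Real.pi_gt_three
    linarith

/-- Schwartz functions belong to all modulation spaces. -/
lemma modulationENorm_coe_lt_top (φ : 𝓢(EuclideanSpace ℝ (Fin n), ℂ)) (p : ℝ≥0∞) {q : ℝ≥0∞}
    [Fact (1 ≤ p)] (hq : 1 ≤ q) (r : ℝ) (f : 𝓢(EuclideanSpace ℝ (Fin n), ℂ)) :
    modulationENorm φ p q r (f : 𝓢'(EuclideanSpace ℝ (Fin n), ℂ)) < ∞ := by
  obtain ⟨M, hM⟩ := exists_nat_ge (r + (n + 1))
  obtain ⟨C, hC0, hC⟩ := exists_lpENorm_boxOperator_coe_le p φ f M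
  have hn0 : (0 : ℝ) ≤ n := n.cast_nonneg
  rw [modulationENorm]
  split_ifs with hqt
  · refine lt_of_le_of_lt (iSup_le fun k => ?_) (ENNReal.ofReal_lt_top (r := C))
    have hb := japaneseBracket_pos (latticePoint k)
    calc _ ≤ ENNReal.ofReal (japaneseBracket (latticePoint k) ^ r) *
          ENNReal.ofReal (C * japaneseBracket (latticePoint k) ^ (-(M : ℝ))) := by
            gcongr
            exact hC k
      _ ≤ ENNReal.ofReal C := by
          rw [← ENNReal.ofReal_mul (by positivity)]
          refine ENNReal.ofReal_le_ofReal ?_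
          rw [mul_left_comm, ← Real.rpow_add hb]
          exact mul_le_of_le_one_right hC0
            (Real.rpow_le_one_of_one_le_of_nonpos (one_le_japaneseBracket _) (by linarith))
  · have hq1 : 1 ≤ q.toReal := by
      rw [← ENNReal.toReal_one]
      exact ENNReal.toReal_mono hqt hq
    refine ENNReal.rpow_lt_top_of_nonneg (by positivity) (ne_of_lt ?_)
    have hs := summable_japaneseBracket_latticePoint (n := n) (t := -(n + 1)) (by linarith)
    have hs' := (hs.mul_left (C ^ q.toReal)).tsum_ofReal_lt_top
    refine lt_of_le_of_lt (ENNReal.tsum_le_tsum fun k => ?_) hs'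
    have hb := japaneseBracket_pos (latticePoint k)
    calc _ ≤ ENNReal.ofReal (japaneseBracket (latticePoint k) ^ (r * q.toReal)) *
          ENNReal.ofReal (C * japaneseBracket (latticePoint k) ^ (-(M : ℝ))) ^ q.toReal := by
            gcongr
            exact hC k
      _ ≤ _ := by
          rw [ENNReal.ofReal_rpow_of_nonneg (by positivity) (by linarith),
            ← ENNReal.ofReal_mul (by positivity)]
          refine ENNReal.ofReal_le_ofReal ?_
          rw [Real.mul_rpow hC0 (by positivity), mul_left_comm, ← Real.rpow_mul hb.le,
            ← Real.rpow_add hb]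
          gcongr
          · exact one_le_japaneseBracket _
          · nlinarith

end Finiteness

section Comparison

variable {n : ℕ}

/-- Blockwise bounds with a power weight give bounds between modulation spaces. -/
lemma modulationENorm_le_of_forall_boxOperator {φ : 𝓢(EuclideanSpace ℝ (Fin n), ℂ)} {p : ℝ≥0∞}
    (q : ℝ≥0∞) [Fact (1 ≤ p)] (s : ℝ) {σ C : ℝ} (hC : 0 < C)
    {u v : 𝓢'(EuclideanSpace ℝ (Fin n), ℂ)} (hq : 1 ≤ q)
    (huv : ∀ k : Fin n → ℤ, lpENorm p (boxOperator φ k u) ≤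
      ENNReal.ofReal (C * japaneseBracket (latticePoint k) ^ σ) * lpENorm p (boxOperator φ k v)) :
    modulationENorm φ p q s u ≤ ENNReal.ofReal C * modulationENorm φ p q (s + σ) v := by
  rw [modulationENorm, modulationENorm]
  split_ifs with hqt
  · rw [ENNReal.mul_iSup]
    refine iSup_mono fun k => ?_
    have hb := japaneseBracket_pos (latticePoint k)
    calc _ ≤ ENNReal.ofReal (japaneseBracket (latticePoint k) ^ s) *
          (ENNReal.ofReal (C * japaneseBracket (latticePoint k) ^ σ) *
            lpENorm p (boxOperator φ k v)) := by gcongr; exact huv k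
      _ = _ := by
        rw [← mul_assoc, ← mul_assoc, ← ENNReal.ofReal_mul (by positivity),
          ← ENNReal.ofReal_mul hC.le, Real.rpow_add hb]
        congr 2
        ring
  · have hq0 : 0 < q.toReal := ENNReal.toReal_pos (by positivity) hqt
    have hterm (k : Fin n → ℤ) :
        ENNReal.ofReal (japaneseBracket (latticePoint k) ^ (s * q.toReal)) *
          lpENorm p (boxOperator φ k u) ^ q.toReal ≤
        ENNReal.ofReal C ^ q.toReal *
          (ENNReal.ofReal (japaneseBracket (latticePoint k) ^ ((s + σ) * q.toReal)) *
          lpENorm p (boxOperator φ k v) ^ q.toReal) := by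
      have hb := japaneseBracket_pos (latticePoint k)
      calc _ ≤ ENNReal.ofReal (japaneseBracket (latticePoint k) ^ (s * q.toReal)) *
            (ENNReal.ofReal (C * japaneseBracket (latticePoint k) ^ σ) *
              lpENorm p (boxOperator φ k v)) ^ q.toReal := by gcongr; exact huv k
        _ = _ := by
          rw [ENNReal.mul_rpow_of_nonneg _ _ hq0.le, ← mul_assoc, ← mul_assoc,
            ENNReal.ofReal_rpow_of_nonneg (by positivity) hq0.le,
            ENNReal.ofReal_rpow_of_nonneg hC.le hq0.le, ← ENNReal.ofReal_mul (by positivity),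
            ← ENNReal.ofReal_mul (by positivity), Real.mul_rpow hC.le (by positivity),
            ← Real.rpow_mul hb.le, add_mul, Real.rpow_add hb]
          congr 2
          ring
    have hsum := ENNReal.tsum_le_tsum hterm
    rw [ENNReal.tsum_mul_left] at hsum
    calc _ ≤ _ := ENNReal.rpow_le_rpow hsum (by positivity)
      _ = _ := by
        rw [ENNReal.mul_rpow_of_nonneg _ _ (by positivity), ← ENNReal.rpow_mul,
          mul_one_div_cancel hq0.ne', ENNReal.rpow_one]

end Comparison

section Multiplier

variable {n : ℕ}

lemma norm_exp_I_mul_ofReal (t : ℝ) : ‖Complex.exp (Complex.I * (t : ℂ))‖ = 1 := by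
  rw [mul_comm, Complex.norm_exp_ofReal_mul_I]

lemma integrable_exp_mul_fourier {α : ℝ} (hα : 2 < α) (f : 𝓢(EuclideanSpace ℝ (Fin n), ℂ)) :
    Integrable fun η : EuclideanSpace ℝ (Fin n) =>
      Complex.exp (Complex.I * ((‖(2 * Real.pi) • η‖ ^ α : ℝ) : ℂ)) *
        𝓕 (f : EuclideanSpace ℝ (Fin n) → ℂ) η := by
  have hf : Integrable (𝓕 (f : EuclideanSpace ℝ (Fin n) → ℂ)) := by
    rw [← SchwartzMap.fourier_coe]
    exact (𝓕 f : 𝓢(EuclideanSpace ℝ (Fin n), ℂ)).integrable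
  refine hf.bdd_mul (c := 1) ?_ (ae_of_all _ fun η => (norm_exp_I_mul_ofReal _).le)
  have : Continuous fun η : EuclideanSpace ℝ (Fin n) => ‖(2 * Real.pi) • η‖ ^ α :=
    (continuous_norm.comp (continuous_const_smul _)).rpow_const fun _ => Or.inr (by linarith)
  exact (Complex.continuous_exp.comp
    (continuous_const.mul (Complex.continuous_ofReal.comp this))).aestronglyMeasurable

/-- Frequency-uniform block estimate for `e^{i|D|^α}`. -/
lemma exists_lpENorm_boxOperator_unimodularMultiplier_le {φ : 𝓢(EuclideanSpace ℝ (Fin n), ℂ)}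
    (hφ : IsModulationWindow φ) (p : ℝ≥0∞) [Fact (1 ≤ p)] {α : ℝ} (hα : 2 < α) :
    ∃ C : ℝ, 0 < C ∧ ∀ (f : 𝓢(EuclideanSpace ℝ (Fin n), ℂ))
      (u : 𝓢'(EuclideanSpace ℝ (Fin n), ℂ)),
      (∀ ψ : 𝓢(EuclideanSpace ℝ (Fin n), ℂ), u ψ = ∫ x, ψ x • unimodularMultiplier α f x) →
      ∀ k : Fin n → ℤ, lpENorm p (boxOperator φ k u) ≤
        ENNReal.ofReal (C * japaneseBracket (latticePoint k) ^
          ((α - 2) * n * |(p⁻¹).toReal - 1 / 2|)) *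
        lpENorm p (boxOperator φ k (f : 𝓢'(EuclideanSpace ℝ (Fin n), ℂ))) := by
  have hpi : (2 * Real.pi) ≠ 0 := by positivity
  have hp : 1 ≤ p := Fact.out
  let χ : ContDiffBump (0 : EuclideanSpace ℝ (Fin n)) :=
    ⟨Real.sqrt n + 1, Real.sqrt n + 2, by positivity, by linarith⟩
  obtain ⟨B, hB, hW⟩ := exists_isWiener_block_norm_rpow hα χ
  obtain ⟨D, hD, hconv⟩ := exists_eLpNorm_cconv_le (EuclideanSpace ℝ (Fin n)) hp
  set τ := |(p⁻¹).toReal - 1 / 2| with hτ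
  refine ⟨D * (B.toReal + 1) ^ (2 * τ), by positivity, fun f u hu k => ?_⟩
  set a := (2 * Real.pi)⁻¹ • latticePoint k with ha
  have hb := japaneseBracket_pos (latticePoint k)
  have h2a : (2 * Real.pi) • a = latticePoint k := smul_inv_smul₀ hpi _
  obtain ⟨K, hK, hKm, hKA⟩ := hW a
  rw [h2a, finrank_euclideanSpace_fin] at hKA
  set A := (B.toReal + 1) * japaneseBracket (latticePoint k) ^ ((α - 2) * n / 2) with hA
  have hA0 : 0 < A := by positivity
  have hKA' : eLpNorm K 1 volume ≤ ENNReal.ofReal A := by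
    refine hKA.trans ?_
    rw [hA, ENNReal.ofReal_mul (by positivity)]
    gcongr
    · rw [← ENNReal.ofReal_toReal hB]
      exact ENNReal.ofReal_le_ofReal (by simp)
    · rfl
  have hK1 (ξ) : ‖𝓕 K ξ‖ ≤ 1 := by
    rw [hKm, norm_mul, norm_exp_I_mul_ofReal, mul_one, Complex.norm_real, Real.norm_eq_abs,
      abs_of_nonneg χ.nonneg]
    exact χ.le_one
  have hblock : 𝓕⁻ (fun η => boxSymbol φ k η *
      (Complex.exp (Complex.I * ((‖(2 * Real.pi) • η‖ ^ α : ℝ) : ℂ)) *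
        𝓕 (f : EuclideanSpace ℝ (Fin n) → ℂ) η)) = cconv K (boxSchwartz φ k f) := by
    rw [← fourierInv_mul_fourier_eq_cconv hK]
    congr 1
    funext η
    rw [fourier_boxSchwartz, hKm]
    by_cases h0 : boxSymbol φ k η = 0
    · simp [h0]
    · have hmem := hφ.support_subset (subset_tsupport _ (Function.mem_support.mpr h0))
      rw [Set.mem_ofPred_eq] at hmem
      have hnorm : ‖(2 * Real.pi) • η - latticePoint k‖ ≤ Real.sqrt n := by
        rw [EuclideanSpace.norm_eq]
        refine Real.sqrt_le_sqrt ?_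
        calc _ ≤ ∑ _i : Fin n, (1 : ℝ) := Finset.sum_le_sum fun i _ =>
              pow_le_one₀ (norm_nonneg _) (hmem i)
          _ = n := by simp
      have hχ1 : χ (η - a) = 1 := by
        refine χ.one_of_mem_closedBall ?_
        rw [mem_closedBall_zero_iff]
        have h1 : (2 * Real.pi) * ‖η - a‖ ≤ Real.sqrt n := by
          rw [← h2a, ← smul_sub, norm_smul, Real.norm_eq_abs, abs_of_pos (by positivity)] at hnorm
          exact hnorm
        have : (3 : ℝ) < Real.pi := Real.pi_gt_three
        change ‖η - a‖ ≤ Real.sqrt n + 1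
        nlinarith [norm_nonneg (η - a), Real.sqrt_nonneg (n : ℝ)]
      beta_reduce
      rw [hχ1, Complex.ofReal_one]
      ring
  have hbox (ψ : 𝓢(EuclideanSpace ℝ (Fin n), ℂ)) :
      boxOperator φ k u ψ = ∫ x, ψ x • cconv K (boxSchwartz φ k f) x := by
    rw [← hblock]
    exact boxOperator_apply_of_fourierInv φ k (integrable_exp_mul_fourier hα f) hu ψ
  have hle := hconv K hK A hA0 hKA' hK1 (boxSchwartz φ k f)
  have hmeas : AEStronglyMeasurable (cconv K (boxSchwartz φ k f)) volume :=
    (hK.cconv (boxSchwartz φ k f).integrable).aestronglyMeasurable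
  have hmem : MemLp (cconv K (boxSchwartz φ k f)) p volume :=
    ⟨hmeas, hle.trans_lt (ENNReal.mul_lt_top ENNReal.ofReal_lt_top
      ((boxSchwartz φ k f).memLp p volume).eLpNorm_lt_top)⟩
  refine (lpENorm_le_eLpNorm hmem hbox).trans (hle.trans (le_of_eq ?_))
  rw [boxOperator_coe, lpENorm_coe, hA, Real.mul_rpow (by positivity) (by positivity),
    ← Real.rpow_mul hb.le, ← mul_assoc, show (α - 2) * n / 2 * (2 * τ) = (α - 2) * n * τ by ring]

/-- A locally integrable function represented by an `L^p` function as a distribution agrees with it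
almost everywhere. -/
lemma ae_eq_of_forall_schwartz_integral_eq {g h : EuclideanSpace ℝ (Fin n) → ℂ}
    (hg : LocallyIntegrable g) (hh : LocallyIntegrable h)
    (H : ∀ ψ : 𝓢(EuclideanSpace ℝ (Fin n), ℂ), ∫ x, ψ x • g x = ∫ x, ψ x • h x) :
    g =ᵐ[volume] h := by
  refine ae_eq_of_integral_contDiff_smul_eq hg hh fun ρ hρ hρc => ?_
  have h1 : HasCompactSupport (Complex.ofRealCLM ∘ ρ) := hρc.comp_left rfl
  have h2 : ContDiff ℝ (⊤ : ℕ∞) (Complex.ofRealCLM ∘ ρ) := by fun_prop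
  simpa using H (h1.toSchwartzMap h2)

lemma continuous_unimodularMultiplier {α : ℝ} (hα : 2 < α)
    (f : 𝓢(EuclideanSpace ℝ (Fin n), ℂ)) : Continuous (unimodularMultiplier α f) :=
  VectorFourier.fourierIntegral_continuous Real.continuous_fourierChar
    (continuous_inner (𝕜 := ℝ) (E := EuclideanSpace ℝ (Fin n))).neg
    (integrable_exp_mul_fourier hα f)

lemma memLp_top_unimodularMultiplier {α : ℝ} (hα : 2 < α)
    (f : 𝓢(EuclideanSpace ℝ (Fin n), ℂ)) : MemLp (unimodularMultiplier α f) ∞ volume :=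
  memLp_top_of_bound (continuous_unimodularMultiplier hα f).aestronglyMeasurable _
    (ae_of_all _ fun _ => VectorFourier.norm_fourierIntegral_le_integral_norm _ _ _ _ _)

end Multiplier

theorem mainTheorem7 (n : ℕ) (hn : 1 ≤ n) (φ : 𝓢(EuclideanSpace ℝ (Fin n), ℂ))
    (hφ : IsModulationWindow φ) (p q : ℝ≥0∞) [Fact (1 ≤ p)] (hq : 1 ≤ q) (s α : ℝ) (hα : 2 < α)
    (hemb : ModulationEmbedsInLp φ p q s) :
    IsBoundedModulationToLp φ p q (s + (α - 2) * n * |(p⁻¹).toReal - 1 / 2|)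
      (unimodularMultiplier α) := by
  obtain ⟨C₀, hC₀, hembed⟩ := hemb
  obtain ⟨C, hC, hbox⟩ := exists_lpENorm_boxOperator_unimodularMultiplier_le hφ p hα
  refine ⟨C₀ * C.toNNReal, mul_pos hC₀ (Real.toNNReal_pos.mpr hC), fun f => ?_⟩
  have hTop := memLp_top_unimodularMultiplier hα f
  set u : 𝓢'(EuclideanSpace ℝ (Fin n), ℂ) := Lp.toTemperedDistribution (hTop.toLp _) with hu_def
  have hu (ψ : 𝓢(EuclideanSpace ℝ (Fin n), ℂ)) :
      u ψ = ∫ x, ψ x • unimodularMultiplier α f x := by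
    rw [hu_def, Lp.toTemperedDistribution_apply]
    refine integral_congr_ae ?_
    filter_upwards [hTop.coeFn_toLp] with x hx
    rw [hx]
  have hmod := modulationENorm_le_of_forall_boxOperator q s hC hq (hbox f u hu)
  have hfin : modulationENorm φ p q s u < ∞ := hmod.trans_lt
    (ENNReal.mul_lt_top ENNReal.ofReal_lt_top (modulationENorm_coe_lt_top φ p hq _ f))
  obtain ⟨g, hgu, hgle⟩ := hembed u hfin
  have hae : g =ᵐ[volume] unimodularMultiplier α f := by
    refine ae_eq_of_forall_schwartz_integral_eq ((Lp.memLp g).locallyIntegrable Fact.out)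
      (hTop.locallyIntegrable le_top) fun ψ => ?_
    rw [← hu, ← hgu, Lp.toTemperedDistribution_apply]
  refine ⟨(Lp.memLp g).ae_eq hae, ?_⟩
  rw [← eLpNorm_congr_ae hae, ← Lp.enorm_def]
  refine hgle.trans ?_
  rw [ENNReal.coe_mul, mul_assoc]
  gcongr
  exact hmod
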